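/- Let $\mathbb K$ be an algebraically closed field of characteristic $0$, let $q\in\mathbb K^*$, put $[k]=\frac{q^k-q^{-k}}{q-q^{-1}}$, and assume that $q$ has finite characteristic $\ell>2$, i.e. $\ell>2$ is the least positive integer with $[\ell]=0$. Let $m\ge 2$, $n\ge 0$, and let $u_q=u_q(\mathfrak{gl}(m|n))$ be the small quantum general linear superalgebra (generators $e_j,f_j$ for $1\le j<m+n$ and $K_i^{\pm1}$ for $1\le i\le m+n$; it is the quotient of $U_q(\mathfrak{gl}(m|n))$ by the $\ell$-th powers of the even root vectors and by $K_i^{2\ell}-1$). The quantum Grassmann superalgebra $\Omega_q(m|n)$ has as basis the monomials $x^{\langle\alpha,\mu\rangle}=x^{(\alpha)}\otimes x^\mu$ with $\alpha\in\mathbb Z_{\ge0}^m$, $\mu\in\{0,1\}^n$, and $u_q$ acts on it as follows (a monomial with an exponent outside $\mathbb Z_{\ge0}^m\times\{0,1\}^n$ is read as $0$). For $j<m$, $e_j$ sends $x^{\langle\alpha,\mu\rangle}$ to $[\alpha_j+1]\,x^{\langle\alpha+\varepsilon_j-\varepsilon_{j+1},\mu\rangle}$ and $f_j$ sends it to $[\alpha_{j+1}+1]\,x^{\langle\alpha-\varepsilon_j+\varepsilon_{j+1},\mu\rangle}$.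 If $n\ge1$, $e_m$ sends it to $[\alpha_m+1]\,x^{\langle\alpha+\varepsilon_m,\mu-\varepsilon_1\rangle}$ and $f_m$ sends it to $x^{\langle\alpha-\varepsilon_m,\mu+\varepsilon_1\rangle}$. For $1\le k<n$, $e_{m+k}$ sends it to $x^{\langle\alpha,\mu+\varepsilon_k-\varepsilon_{k+1}\rangle}$ and $f_{m+k}$ sends it to $x^{\langle\alpha,\mu-\varepsilon_k+\varepsilon_{k+1}\rangle}$. Finally $K_i$ acts by $q^{\alpha_i}$ for $i\le m$, and $K_{m+k}$ acts by $q^{-\mu_k}$ for $1\le k\le n$. For $s\ge 0$ let $\Omega_q^{(s)}(m|n)$ be the submodule spanned by the monomials with $\sum_i\alpha_i+\sum_k\mu_k=s$, and for $r\ge1$ let $\Omega_q^{(s)}(m|n,\mathbf r)$ be the submodule spanned by those of them with $\alpha_i\le r\ell-1$ for all $i$. Put $\mathcal E\langle\alpha,\mu\rangle=(\lfloor\alpha_1/\ell\rfloor,\dots,\lfloor\alpha_m/\ell\rfloor)$ and $|\mathcal E\langle\alpha,\mu\rangle|=\sum_i\lfloor\alpha_i/\ell\rfloor$. Let $x^{\langle\alpha,\mu\rangle}$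 and $x^{\langle\beta,\nu\rangle}$ be two of the basis monomials of $M=\Omega_q^{(s)}(m|n)$, or of $M=\Omega_q^{(s)}(m|n,\mathbf r)$. Then: (i) If $\mathcal E\langle\alpha,\mu\rangle=\mathcal E\langle\beta,\nu\rangle$, then $u_q.x^{\langle\alpha,\mu\rangle}=u_q.x^{\langle\beta,\nu\rangle}$. (ii) If $\mathcal E\langle\alpha,\mu\rangle\ge\mathcal E\langle\beta,\nu\rangle$ componentwise and $\mathcal E\langle\alpha,\mu\rangle\ne\mathcal E\langle\beta,\nu\rangle$, then $u_q.x^{\langle\beta,\nu\rangle}\subsetneq u_q.x^{\langle\alpha,\mu\rangle}$. (iii) If $|\mathcal E\langle\alpha,\mu\rangle|=|\mathcal E\langle\beta,\nu\rangle|$ but $\mathcal E\langle\alpha,\mu\rangle\ne\mathcal E\langle\beta,\nu\rangle$, then the heads of $V=u_q.x^{\langle\alpha,\mu\rangle}$ and $W=u_q.x^{\langle\beta,\nu\rangle}$ intersect trivially. Precisely: writing $\operatorname{Rad}$ for the intersection of all maximal submodules, the natural maps from $V/\operatorname{Rad}V$ and $W/\operatorname{Rad}W$ to $M/(\operatorname{Rad}V+\operatorname{Rad}W)$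 are injective, and their images have intersection $0$. -/

import Mathlib

namespace QGrass

/-- The quantum integer `[k] = (q ^ k - q ^ (-k)) / (q - q ^ (-1))`. -/
def qInt {F : Type*} [Field F] (q : F) (k : ℕ) : F := (q ^ k - q⁻¹ ^ k) / (q - q⁻¹)

/-- `q` is a nonzero scalar of characteristic `ℓ > 2`, the characteristic of `q` being the least
positive integer `k` with `[k] = 0`. -/
structure HasQChar {F : Type*} [Field F] (q : F) (ℓ : ℕ) : Prop where
  ne_zero : q ≠ 0
  isLeast : IsLeast {k : ℕ | 0 < k ∧ qInt q k = 0} ℓ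
  two_lt : 2 < ℓ

/-! ### The small quantum general linear superalgebra

All indices are shifted by one: the index set `I` is `Fin (m + n)`, its even part consists of
the indices with value `< m`, and `J` is `Fin (m + n - 1)`.  The odd simple root is the one with
index `j` such that `j + 1 = m`. -/

/-- The generators `e_j`, `f_j` (`j ∈ J`), `K_i`, `K_i⁻¹` (`i ∈ I`). -/
inductive Gen (m n : ℕ) : Type
  | e (j : Fin (m + n - 1))
  | f (j : Fin (m + n - 1))
  | k (i : Fin (m + n))
  | kinv (i : Fin (m + n))

/-- `j ∈ J` as an element of `I`. -/
def lo {m n : ℕ} (j : Fin (m + n - 1)) : Fin (m + n) := ⟨j.1, by omega⟩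

/-- The successor in `I` of `j ∈ J`. -/
def hi {m n : ℕ} (j : Fin (m + n - 1)) : Fin (m + n) := ⟨j.1 + 1, by omega⟩

/-- `q_i = q` for even `i` and `q_i = q⁻¹` for odd `i`. -/
def qAt {F : Type*} [Field F] (q : F) (m i : ℕ) : F := if i < m then q else q⁻¹

/-- The parity `p(e_j) = p(f_j)`. -/
def parity (m j : ℕ) : ℕ := if j + 1 = m then 1 else 0

section Algebra

variable {F : Type*} [Field F] (q : F) (ℓ m n : ℕ)

/-- The free algebra on the generators. -/
abbrev Free (F : Type*) [Field F] (m n : ℕ) := FreeAlgebra F (Gen m n)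

/-- The generator `e_j` in the free algebra. -/
abbrev E (F : Type*) [Field F] {m n : ℕ} (j : Fin (m + n - 1)) : Free F m n :=
  FreeAlgebra.ι F (Gen.e j)

/-- The generator `f_j` in the free algebra. -/
abbrev Fe (F : Type*) [Field F] {m n : ℕ} (j : Fin (m + n - 1)) : Free F m n :=
  FreeAlgebra.ι F (Gen.f j)

/-- The generator `K_i` in the free algebra. -/
abbrev Kg (F : Type*) [Field F] {m n : ℕ} (i : Fin (m + n)) : Free F m n :=
  FreeAlgebra.ι F (Gen.k i)

/-- The generator `K_i⁻¹` in the free algebra. -/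
abbrev Ki (F : Type*) [Field F] {m n : ℕ} (i : Fin (m + n)) : Free F m n :=
  FreeAlgebra.ι F (Gen.kinv i)

variable {m n}

/-- The positive root vector of the root `ε_a - ε_(a+d+1)`: `e_a` for `d = 0`, and
`E_(a,c+1) = E_(a,c) e_c - q_c⁻¹ e_c E_(a,c)`. -/
def rootE (a : ℕ) : (d : ℕ) → a + d < m + n - 1 → Free F m n
  | 0, h => E F ⟨a, h⟩
  | d + 1, h =>
    rootE a d (by omega) * E F ⟨a + (d + 1), h⟩
      - (qAt q m (a + (d + 1)))⁻¹ • (E F ⟨a + (d + 1), h⟩ * rootE a d (by omega))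

/-- The negative root vector of the root `ε_(a+d+1) - ε_a`: `f_a` for `d = 0`, and
`F_(c+1,a) = f_c F_(c,a) - q_c F_(c,a) f_c`. -/
def rootF (a : ℕ) : (d : ℕ) → a + d < m + n - 1 → Free F m n
  | 0, h => Fe F ⟨a, h⟩
  | d + 1, h =>
    Fe F ⟨a + (d + 1), h⟩ * rootF a d (by omega)
      - qAt q m (a + (d + 1)) • (rootF a d (by omega) * Fe F ⟨a + (d + 1), h⟩)

variable (m n)

/-- The defining relations of the small quantum superalgebra `u_q(gl(m|n))`: the defining
relations of `U_q(gl(m|n))`, the vanishing of the `ℓ`-th powers of all even root vectors, and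
`K_i ^ (2 ℓ) = 1`. -/
inductive Rel : Free F m n → Free F m n → Prop
  | k_comm (i j) : Rel (Kg F i * Kg F j) (Kg F j * Kg F i)
  | k_kinv (i) : Rel (Kg F i * Ki F i) 1
  | kinv_k (i) : Rel (Ki F i * Kg F i) 1
  | k_e (i : Fin (m + n)) (j : Fin (m + n - 1)) :
      Rel (Kg F i * E F j)
        (qAt q m i ^ ((if i = lo j then 1 else 0) - (if i = hi j then 1 else 0) : ℤ) •
          (E F j * Kg F i))
  | k_f (i : Fin (m + n)) (j : Fin (m + n - 1)) :
      Rel (Kg F i * Fe F j)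
        (qAt q m i ^ ((if i = hi j then 1 else 0) - (if i = lo j then 1 else 0) : ℤ) •
          (Fe F j * Kg F i))
  | e_f_self (i : Fin (m + n - 1)) :
      Rel (E F i * Fe F i - (-1 : F) ^ (parity m i * parity m i) • (Fe F i * E F i))
        ((qAt q m i - (qAt q m i)⁻¹)⁻¹ •
          (Kg F (lo i) * Ki F (hi i) - Ki F (lo i) * Kg F (hi i)))
  | e_f_ne (i j : Fin (m + n - 1)) (h : i ≠ j) :
      Rel (E F i * Fe F j - (-1 : F) ^ (parity m i * parity m j) • (Fe F j * E F i)) 0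
  | e_e (i j : Fin (m + n - 1)) (h : i.1 + 1 < j.1 ∨ j.1 + 1 < i.1) :
      Rel (E F i * E F j) (E F j * E F i)
  | f_f (i j : Fin (m + n - 1)) (h : i.1 + 1 < j.1 ∨ j.1 + 1 < i.1) :
      Rel (Fe F i * Fe F j) (Fe F j * Fe F i)
  | serre_e (i j : Fin (m + n - 1)) (h : i.1 + 1 = j.1 ∨ j.1 + 1 = i.1) (hi : i.1 + 1 ≠ m) :
      Rel (E F i * E F i * E F j - (q + q⁻¹) • (E F i * E F j * E F i) + E F j * E F i * E F i) 0
  | serre_f (i j : Fin (m + n - 1)) (h : i.1 + 1 = j.1 ∨ j.1 + 1 = i.1) (hi : i.1 + 1 ≠ m) :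
      Rel (Fe F i * Fe F i * Fe F j - (q + q⁻¹) • (Fe F i * Fe F j * Fe F i)
        + Fe F j * Fe F i * Fe F i) 0
  | e_odd (b : Fin (m + n - 1)) (hb : b.1 + 1 = m) : Rel (E F b * E F b) 0
  | f_odd (b : Fin (m + n - 1)) (hb : b.1 + 1 = m) : Rel (Fe F b * Fe F b) 0
  | super_e (a b c : Fin (m + n - 1)) (hb : b.1 + 1 = m) (hab : a.1 + 1 = b.1)
      (hbc : b.1 + 1 = c.1) :
      Rel (E F a * E F b * E F c * E F b + E F b * E F a * E F b * E F c
        + E F c * E F b * E F a * E F b + E F b * E F c * E F b * E F a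
        - (q + q⁻¹) • (E F b * E F a * E F c * E F b)) 0
  | super_f (a b c : Fin (m + n - 1)) (hb : b.1 + 1 = m) (hab : a.1 + 1 = b.1)
      (hbc : b.1 + 1 = c.1) :
      Rel (Fe F a * Fe F b * Fe F c * Fe F b + Fe F b * Fe F a * Fe F b * Fe F c
        + Fe F c * Fe F b * Fe F a * Fe F b + Fe F b * Fe F c * Fe F b * Fe F a
        - (q + q⁻¹) • (Fe F b * Fe F a * Fe F c * Fe F b)) 0
  | rootE_pow (a d : ℕ) (h : a + d < m + n - 1) (hev : a + d + 1 < m ∨ m ≤ a) :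
      Rel (rootE q a d h ^ ℓ) 0
  | rootF_pow (a d : ℕ) (h : a + d < m + n - 1) (hev : a + d + 1 < m ∨ m ≤ a) :
      Rel (rootF q a d h ^ ℓ) 0
  | k_pow (i : Fin (m + n)) : Rel (Kg F i ^ (2 * ℓ)) 1

/-- The small quantum general linear superalgebra `u_q(gl(m|n))`. -/
abbrev SmallQ := RingQuot (Rel q ℓ m n)

end Algebra

/-! ### The quantum Grassmann superalgebra as a vector space with operators -/

/-- The set `ℤ₊^m × ℤ₂^n` of tuples `⟨α, μ⟩`. -/
abbrev Tuple (m n : ℕ) := (Fin m → ℕ) × (Fin n → Fin 2)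

/-- `|⟨α, μ⟩| = ∑ α_i + ∑ μ_i`. -/
def Tuple.deg {m n : ℕ} (t : Tuple m n) : ℕ := ∑ i, t.1 i + ∑ k, (t.2 k : ℕ)

/-- The energy vector `(⌊α_1 / ℓ⌋, …, ⌊α_m / ℓ⌋)` of `⟨α, μ⟩`. -/
def Tuple.energy {m n : ℕ} (ℓ : ℕ) (t : Tuple m n) : Fin m → ℕ := fun i => t.1 i / ℓ

section Operators

variable {F : Type*} [Field F] (q : F) {ℓ m n : ℕ}

/-- The entry of `⟨α, μ⟩` at a position. -/
def entry (p : Fin m ⊕ Fin n) (t : Tuple m n) : ℕ :=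
  Sum.elim t.1 (fun k => (t.2 k : ℕ)) p

/-- Increase one entry of a monomial, with coefficient `[α_i + 1]` at an even position and
`δ_(0, μ_k)` at an odd one. -/
noncomputable def raiseMono : Fin m ⊕ Fin n → Tuple m n → (Tuple m n →₀ F)
  | .inl i, t => Finsupp.single (Function.update t.1 i (t.1 i + 1), t.2) (qInt q (t.1 i + 1))
  | .inr k, t => if t.2 k = 0 then Finsupp.single (t.1, Function.update t.2 k 1) 1 else 0

/-- Decrease one entry of a monomial; the result is `0` if that entry is `0`. -/
noncomputable def lowerMono (F : Type*) [Field F] :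
    Fin m ⊕ Fin n → Tuple m n → (Tuple m n →₀ F)
  | .inl i, t =>
    if t.1 i = 0 then 0 else Finsupp.single (Function.update t.1 i (t.1 i - 1), t.2) 1
  | .inr k, t => if t.2 k = 1 then Finsupp.single (t.1, Function.update t.2 k 0) 1 else 0

/-- Linear extension of `raiseMono`. -/
noncomputable def raise (p : Fin m ⊕ Fin n) : Module.End F (Tuple m n →₀ F) :=
  Finsupp.linearCombination F (raiseMono q p)

/-- Linear extension of `lowerMono`. -/
noncomputable def lower (F : Type*) [Field F] (p : Fin m ⊕ Fin n) :
    Module.End F (Tuple m n →₀ F) :=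
  Finsupp.linearCombination F (lowerMono F p)

/-- The diagonal operator `x^⟨α,μ⟩ ↦ c ^ (entry at p) x^⟨α,μ⟩`. -/
noncomputable def diag (c : F) (p : Fin m ⊕ Fin n) : Module.End F (Tuple m n →₀ F) :=
  Finsupp.linearCombination F (fun t => Finsupp.single t (c ^ entry p t))

/-- An index in `I` as an even or odd position. -/
def pos (i : Fin (m + n)) : Fin m ⊕ Fin n := finSumFinEquiv.symm i

/-- The action of the generators on monomials: `e_j` moves one unit from the entry `j + 1` to the
entry `j` (both seen in the `(m+n)`-tuple `⟨α, μ⟩`) and `f_j` moves one unit from `j` to `j + 1`;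
the coefficient is `[new entry]` if the entry that grows is even and `1` if it is odd, and the
result is `0` if the move leaves `ℤ₊^m × ℤ₂^n`.  `K_i` acts by `q ^ α_i`, resp. `q ^ (-μ_i)`. -/
noncomputable def genOp : Gen m n → Module.End F (Tuple m n →₀ F)
  | .e j => raise q (pos (lo j)) * lower F (pos (hi j))
  | .f j => raise q (pos (hi j)) * lower F (pos (lo j))
  | .k i => diag (qAt q m i) (pos i)
  | .kinv i => diag (qAt q m i)⁻¹ (pos i)

theorem raise_single (p : Fin m ⊕ Fin n) (t : Tuple m n) :
    raise q p (Finsupp.single t 1) = raiseMono q p t := by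
  simp [raise]

theorem lower_single (p : Fin m ⊕ Fin n) (t : Tuple m n) :
    lower F p (Finsupp.single t 1) = lowerMono F p t := by
  simp [lower]

theorem diag_single (c : F) (p : Fin m ⊕ Fin n) (t : Tuple m n) :
    diag c p (Finsupp.single t 1) = c ^ entry p t • Finsupp.single t 1 := by
  simp [diag]

theorem single_eq_smul (t : Tuple m n) (c : F) :
    (Finsupp.single t c : Tuple m n →₀ F) = c • Finsupp.single t 1 := by simp

theorem end_ext {f g : Module.End F (Tuple m n →₀ F)}
    (h : ∀ t, f (Finsupp.single t 1) = g (Finsupp.single t 1)) : f = g := by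
  ext1 t
  ext1
  exact h t

theorem raise_inl (i : Fin m) (t : Tuple m n) :
    raise q (.inl i) (Finsupp.single t 1) =
      qInt q (t.1 i + 1) • Finsupp.single (Function.update t.1 i (t.1 i + 1), t.2) 1 := by
  rw [raise_single, raiseMono, single_eq_smul]

theorem raise_inr (k : Fin n) (t : Tuple m n) :
    raise q (.inr k) (Finsupp.single t 1) =
      if t.2 k = 0 then Finsupp.single (t.1, Function.update t.2 k 1) 1 else 0 := by
  rw [raise_single, raiseMono]

theorem lower_inl (i : Fin m) (t : Tuple m n) :
    lower F (.inl i) (Finsupp.single t 1) =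
      if t.1 i = 0 then 0 else Finsupp.single (Function.update t.1 i (t.1 i - 1), t.2) 1 := by
  rw [lower_single, lowerMono]

theorem lower_inr (k : Fin n) (t : Tuple m n) :
    lower F (.inr k) (Finsupp.single t 1) =
      if t.2 k = 1 then Finsupp.single (t.1, Function.update t.2 k 0) 1 else 0 := by
  rw [lower_single, lowerMono]

theorem raise_comm (p r : Fin m ⊕ Fin n) : raise q p * raise q r = raise q r * raise q p := by
  by_cases hpr : p = r
  · rw [hpr]
  apply end_ext
  intro t
  rcases p with i | i <;> rcases r with j | j
  · have h : i ≠ j := fun h => hpr (by rw [h])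
    simp only [Module.End.mul_apply, raise_inl, map_smul, Function.update_of_ne h,
      Function.update_of_ne h.symm, smul_smul, mul_comm]
    rw [Function.update_comm h]
  · simp only [Module.End.mul_apply, raise_inl, raise_inr, map_smul]
    split_ifs <;> simp [raise_inl, raise_inr, *]
  · simp only [Module.End.mul_apply, raise_inl, raise_inr, map_smul]
    split_ifs <;> simp [raise_inl, raise_inr, *]
  · have h : i ≠ j := fun h => hpr (by rw [h])
    simp only [Module.End.mul_apply, raise_inr]
    split_ifs <;> simp [raise_inr, Function.update_of_ne h, Function.update_of_ne h.symm, *]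
    rw [Function.update_comm h]

theorem lower_comm (p r : Fin m ⊕ Fin n) : lower F p * lower F r = lower F r * lower F p := by
  by_cases hpr : p = r
  · rw [hpr]
  apply end_ext
  intro t
  rcases p with i | i <;> rcases r with j | j
  · have h : i ≠ j := fun h => hpr (by rw [h])
    simp only [Module.End.mul_apply, lower_inl]
    split_ifs <;> simp [lower_inl, Function.update_of_ne h, Function.update_of_ne h.symm, *]
    rw [Function.update_comm h]
  · simp only [Module.End.mul_apply, lower_inl, lower_inr]
    split_ifs <;> simp [lower_inl, lower_inr, *]
  · simp only [Module.End.mul_apply, lower_inl, lower_inr]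
    split_ifs <;> simp [lower_inl, lower_inr, *]
  · have h : i ≠ j := fun h => hpr (by rw [h])
    simp only [Module.End.mul_apply, lower_inr]
    split_ifs <;> simp [lower_inr, Function.update_of_ne h, Function.update_of_ne h.symm, *]
    rw [Function.update_comm h]

theorem raise_lower_comm {p r : Fin m ⊕ Fin n} (hpr : p ≠ r) :
    raise q p * lower F r = lower F r * raise q p := by
  apply end_ext
  intro t
  rcases p with i | i <;> rcases r with j | j
  · have h : i ≠ j := fun h => hpr (by rw [h])
    simp only [Module.End.mul_apply, raise_inl, lower_inl, map_smul, Function.update_of_ne h.symm]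
    split_ifs <;> simp [raise_inl, Function.update_of_ne h, *]
    rw [Function.update_comm h]
  · simp only [Module.End.mul_apply, raise_inl, lower_inr, map_smul]
    split_ifs <;> simp [raise_inl, lower_inr, *]
  · simp only [Module.End.mul_apply, lower_inl, raise_inr]
    split_ifs <;> simp [lower_inl, raise_inr, *]
  · have h : i ≠ j := fun h => hpr (by rw [h])
    simp only [Module.End.mul_apply, raise_inr, lower_inr]
    split_ifs <;> simp [raise_inr, lower_inr, Function.update_of_ne h,
      Function.update_of_ne h.symm, *]
    rw [Function.update_comm h]

theorem raise_lower_even (i : Fin m) (t : Tuple m n) :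
    raise q (.inl i) (lower F (.inl i) (Finsupp.single t 1)) =
      qInt q (t.1 i) • Finsupp.single t 1 := by
  rw [lower_inl]
  split_ifs with h
  · simp [h, qInt]
  · rw [raise_inl]
    have : t.1 i - 1 + 1 = t.1 i := by omega
    simp [this]

theorem lower_raise_even (i : Fin m) (t : Tuple m n) :
    lower F (.inl i) (raise q (.inl i) (Finsupp.single t 1)) =
      qInt q (t.1 i + 1) • Finsupp.single t 1 := by
  rw [raise_inl, map_smul, lower_inl]
  simp

theorem raise_lower_odd (k : Fin n) (t : Tuple m n) :
    raise q (.inr k) (lower F (.inr k) (Finsupp.single t 1)) =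
      if t.2 k = 1 then Finsupp.single t 1 else 0 := by
  rw [lower_inr]
  split_ifs with h
  · rw [raise_inr]
    simp [← h]
  · simp

theorem lower_raise_odd (k : Fin n) (t : Tuple m n) :
    lower F (.inr k) (raise q (.inr k) (Finsupp.single t 1)) =
      if t.2 k = 0 then Finsupp.single t 1 else 0 := by
  rw [raise_inr]
  split_ifs with h
  · rw [lower_inr]
    simp [← h]
  · simp

theorem raise_sq_odd (k : Fin n) :
    raise q (.inr k) * raise q (.inr k : Fin m ⊕ Fin n) = 0 := by
  apply end_ext
  intro t
  rw [Module.End.mul_apply, raise_inr]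
  split_ifs <;> simp [raise_inr]

theorem lower_sq_odd (k : Fin n) :
    lower F (.inr k) * lower F (.inr k : Fin m ⊕ Fin n) = 0 := by
  apply end_ext
  intro t
  rw [Module.End.mul_apply, lower_inr]
  split_ifs <;> simp [lower_inr]


theorem diag_mul_raise (c : F) (p r : Fin m ⊕ Fin n) :
    diag c p * raise q r = c ^ (if p = r then 1 else 0 : ℤ) • (raise q r * diag c p) := by
  apply end_ext
  intro t
  rcases p with i | i <;> rcases r with j | j
  · simp only [Module.End.mul_apply, LinearMap.smul_apply, raise_inl, diag_single, map_smul,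
      smul_smul]
    congr 1
    by_cases h : i = j
    · subst h
      simp only [entry, Sum.elim_inl, Function.update_self, if_true, zpow_one, pow_succ]
      ring
    · have h' : (Sum.inl i : Fin m ⊕ Fin n) ≠ Sum.inl j := fun e => h (Sum.inl.inj e)
      simp only [entry, Sum.elim_inl, Function.update_of_ne h, if_neg h', zpow_zero]
      ring
  · simp only [Module.End.mul_apply, LinearMap.smul_apply, raise_inr, diag_single, map_smul]
    split_ifs <;> simp [diag_single, entry] at *
  · simp only [Module.End.mul_apply, LinearMap.smul_apply, raise_inl, diag_single, map_smul,
      smul_smul]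
    simp [entry, mul_comm]
  · simp only [Module.End.mul_apply, LinearMap.smul_apply, raise_inr, diag_single, map_smul]
    by_cases h : i = j
    · subst h
      by_cases h0 : t.2 i = 0
      · rw [if_pos h0, diag_single]
        simp [entry, h0]
      · simp [h0]
    · have h' : (Sum.inr i : Fin m ⊕ Fin n) ≠ Sum.inr j := fun e => h (Sum.inr.inj e)
      by_cases h0 : t.2 j = 0
      · rw [if_pos h0, if_neg h', diag_single]
        simp only [entry, Sum.elim_inr, Function.update_of_ne h, zpow_zero, one_smul]
      · simp [h0]

theorem diag_mul_lower (c : F) (hc : c ≠ 0) (p r : Fin m ⊕ Fin n) :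
    diag c p * lower F r = c ^ (if p = r then -1 else 0 : ℤ) • (lower F r * diag c p) := by
  apply end_ext
  intro t
  rcases p with i | i <;> rcases r with j | j
  · simp only [Module.End.mul_apply, LinearMap.smul_apply, lower_inl, diag_single, map_smul]
    by_cases h0 : t.1 j = 0
    · simp [h0]
    rw [if_neg h0, diag_single, smul_smul]
    congr 1
    by_cases h : i = j
    · subst h
      obtain ⟨a, ha⟩ := Nat.exists_eq_succ_of_ne_zero h0
      simp only [entry, Sum.elim_inl, Function.update_self, if_true, ha, Nat.succ_eq_add_one,
        Nat.add_sub_cancel, pow_succ, zpow_neg, zpow_one]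
      field_simp
    · have h' : (Sum.inl i : Fin m ⊕ Fin n) ≠ Sum.inl j := fun e => h (Sum.inl.inj e)
      simp only [entry, Sum.elim_inl, Function.update_of_ne h, if_neg h', zpow_zero, one_mul]
  · simp only [Module.End.mul_apply, LinearMap.smul_apply, lower_inr, diag_single, map_smul]
    split_ifs <;> simp [diag_single, entry] at *
  · simp only [Module.End.mul_apply, LinearMap.smul_apply, lower_inl, diag_single, map_smul]
    split_ifs <;> simp [diag_single, entry] at *
  · simp only [Module.End.mul_apply, LinearMap.smul_apply, lower_inr, diag_single, map_smul]
    by_cases h : i = j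
    · subst h
      by_cases h0 : t.2 i = 1
      · rw [if_pos h0, diag_single]
        simp [entry, h0, hc]
      · simp [h0]
    · have h' : (Sum.inr i : Fin m ⊕ Fin n) ≠ Sum.inr j := fun e => h (Sum.inr.inj e)
      by_cases h0 : t.2 j = 1
      · rw [if_pos h0, if_neg h', diag_single]
        simp only [entry, Sum.elim_inr, Function.update_of_ne h, zpow_zero, one_smul]
      · simp [h0]

theorem diag_comm (c d : F) (p r : Fin m ⊕ Fin n) : diag c p * diag d r = diag d r * diag c p := by
  apply end_ext
  intro t
  simp only [Module.End.mul_apply, diag_single, map_smul, smul_smul, mul_comm]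

theorem diag_mul_inv (c : F) (hc : c ≠ 0) (p : Fin m ⊕ Fin n) : diag c p * diag c⁻¹ p = 1 := by
  apply end_ext
  intro t
  simp only [Module.End.mul_apply, diag_single, map_smul, smul_smul]
  rw [← mul_pow, inv_mul_cancel₀ hc]
  simp

theorem diag_pow (c : F) (p : Fin m ⊕ Fin n) (k : ℕ) : diag c p ^ k = diag (c ^ k) p := by
  induction k with
  | zero =>
    apply end_ext
    intro t
    simp [diag_single]
  | succ k ih =>
    apply end_ext
    intro t
    rw [pow_succ, ih, Module.End.mul_apply, diag_single, map_smul, diag_single, diag_single,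
      smul_smul, ← mul_pow, mul_comm, pow_succ]

theorem qInt_three {q : F} (h0 : q ≠ 0) (a : ℕ) :
    qInt q (a + 2) - (q + q⁻¹) * qInt q (a + 1) + qInt q a = 0 := by
  rw [qInt, qInt, qInt, ← mul_div_assoc, ← sub_div, ← add_div, div_eq_zero_iff]
  left
  have : q * q⁻¹ = 1 := mul_inv_cancel₀ h0
  linear_combination (-q ^ a + q⁻¹ ^ a) * this

theorem osc_lrr {q : F} (h0 : q ≠ 0) (i : Fin m) :
    lower F (.inl i) * raise q (.inl i) * raise q (.inl i)
      - (q + q⁻¹) • (raise q (.inl i) * lower F (.inl i) * raise q (.inl i))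
      + raise q (.inl i) * raise q (.inl i) * lower F (.inl i : Fin m ⊕ Fin n) = 0 := by
  apply end_ext
  intro t
  simp only [LinearMap.add_apply, LinearMap.sub_apply, LinearMap.smul_apply, Module.End.mul_apply,
    raise_lower_even]
  rw [raise_inl]
  simp only [map_smul, raise_lower_even, lower_raise_even, LinearMap.zero_apply, smul_smul]
  rw [raise_inl, smul_smul, ← sub_smul, ← add_smul]
  convert zero_smul F _
  simp only [Function.update_self]
  have := qInt_three h0 (t.1 i)
  linear_combination qInt q (t.1 i + 1) * this

theorem osc_llr {q : F} (h0 : q ≠ 0) (i : Fin m) :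
    lower F (.inl i) * lower F (.inl i) * raise q (.inl i)
      - (q + q⁻¹) • (lower F (.inl i) * raise q (.inl i) * lower F (.inl i))
      + raise q (.inl i) * lower F (.inl i) * lower F (.inl i : Fin m ⊕ Fin n) = 0 := by
  apply end_ext
  intro t
  simp only [LinearMap.add_apply, LinearMap.sub_apply, LinearMap.smul_apply, Module.End.mul_apply,
    raise_lower_even, lower_raise_even, map_smul, LinearMap.zero_apply]
  rw [lower_inl]
  split_ifs with h
  · simp
  · simp only [raise_lower_even, smul_smul]
    rw [← sub_smul, ← add_smul]
    convert zero_smul F _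
    simp only [Function.update_self]
    obtain ⟨a, ha⟩ := Nat.exists_eq_succ_of_ne_zero h
    have := qInt_three h0 a
    rw [ha]
    simpa using this

section Words

variable {V : Type*} [AddCommGroup V] [Module F V]

/-- Reordering for the Serre relations in which the middle position is raised once. -/
theorem word_serre {a b b' c : Module.End F V} (hab : b * a = a * b) (hab' : b' * a = a * b')
    (hac : c * a = a * c) (hcb : c * b = b * c) (z : F)
    (h : a * a * (b * b * b' - z • (b * b' * b) + b' * b * b) = 0) :
    a * b * (a * b) * (b' * c) - z • (a * b * (b' * c) * (a * b)) + b' * c * (a * b) * (a * b)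
      = 0 := by
  have e1 : ∀ x, b * (a * x) = a * (b * x) := fun x => by rw [← mul_assoc, hab, mul_assoc]
  have e2 : ∀ x, b' * (a * x) = a * (b' * x) := fun x => by rw [← mul_assoc, hab', mul_assoc]
  have e3 : ∀ x, c * (a * x) = a * (c * x) := fun x => by rw [← mul_assoc, hac, mul_assoc]
  have e4 : ∀ x, c * (b * x) = b * (c * x) := fun x => by rw [← mul_assoc, hcb, mul_assoc]
  have h1 : a * a * (b * b * b' - z • (b * b' * b) + b' * b * b) * c = 0 := by
    rw [h, zero_mul]
  rw [← h1]
  simp only [mul_add, mul_sub, add_mul, sub_mul, mul_smul_comm, smul_mul_assoc, mul_assoc,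
    e1, e2, e3, e4, hcb]

/-- Reordering for the relations of degree four. -/
theorem word_super {a b b' c c' d : Module.End F V} (hba : b * a = a * b) (hb'a : b' * a = a * b')
    (hca : c * a = a * c) (hc'a : c' * a = a * c') (hda : d * a = a * d)
    (hcb : c * b = b * c) (hc'b : c' * b = b * c') (hdb : d * b = b * d)
    (hcb' : c * b' = b' * c) (hc'b' : c' * b' = b' * c') (hdb' : d * b' = b' * d)
    (hdc : d * c = c * d) (hdc' : d * c' = c' * d) (z : F) (hcc : c * c = 0)
    (h : b * b' * b' - z • (b' * b * b') + b' * b' * b = 0) :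
    a * b * (b' * c) * (c' * d) * (b' * c) + b' * c * (a * b) * (b' * c) * (c' * d)
      + c' * d * (b' * c) * (a * b) * (b' * c) + b' * c * (c' * d) * (b' * c) * (a * b)
      - z • (b' * c * (a * b) * (c' * d) * (b' * c)) = 0 := by
  have e1 : ∀ x, b * (a * x) = a * (b * x) := fun x => by rw [← mul_assoc, hba, mul_assoc]
  have e2 : ∀ x, b' * (a * x) = a * (b' * x) := fun x => by rw [← mul_assoc, hb'a, mul_assoc]
  have e3 : ∀ x, c * (a * x) = a * (c * x) := fun x => by rw [← mul_assoc, hca, mul_assoc]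
  have e4 : ∀ x, c' * (a * x) = a * (c' * x) := fun x => by rw [← mul_assoc, hc'a, mul_assoc]
  have e5 : ∀ x, d * (a * x) = a * (d * x) := fun x => by rw [← mul_assoc, hda, mul_assoc]
  have e6 : ∀ x, c * (b * x) = b * (c * x) := fun x => by rw [← mul_assoc, hcb, mul_assoc]
  have e7 : ∀ x, c' * (b * x) = b * (c' * x) := fun x => by rw [← mul_assoc, hc'b, mul_assoc]
  have e8 : ∀ x, d * (b * x) = b * (d * x) := fun x => by rw [← mul_assoc, hdb, mul_assoc]
  have e9 : ∀ x, c * (b' * x) = b' * (c * x) := fun x => by rw [← mul_assoc, hcb', mul_assoc]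
  have e10 : ∀ x, c' * (b' * x) = b' * (c' * x) := fun x => by rw [← mul_assoc, hc'b', mul_assoc]
  have e11 : ∀ x, d * (b' * x) = b' * (d * x) := fun x => by rw [← mul_assoc, hdb', mul_assoc]
  have e12 : ∀ x, d * (c * x) = c * (d * x) := fun x => by rw [← mul_assoc, hdc, mul_assoc]
  have e13 : ∀ x, d * (c' * x) = c' * (d * x) := fun x => by rw [← mul_assoc, hdc', mul_assoc]
  have e14 : ∀ x, c * (c * x) = 0 := fun x => by rw [← mul_assoc, hcc, zero_mul]
  have h1 : a * (b * b' * b' - z • (b' * b * b') + b' * b' * b) * (c * c' * c * d) = 0 := by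
    rw [h]; simp
  rw [← h1]
  simp only [mul_add, mul_sub, add_mul, sub_mul, mul_smul_comm, smul_mul_assoc, mul_assoc,
    e1, e2, e3, e4, e5, e6, e7, e8, e9, e10, e11, e12, e13, e14, hba, hb'a, hca, hc'a, hda, hcb,
    hc'b, hdb, hcb', hc'b', hdb', hdc, hdc', hcc, mul_zero, zero_mul]
  abel

end Words

theorem pos_inj {i j : Fin (m + n)} : (pos i : Fin m ⊕ Fin n) = pos j ↔ i = j :=
  finSumFinEquiv.symm.injective.eq_iff

theorem pos_even {i : Fin (m + n)} (h : i.1 < m) : (pos i : Fin m ⊕ Fin n) = .inl ⟨i.1, h⟩ := by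
  rw [pos, Equiv.symm_apply_eq]
  rfl

theorem pos_odd {i : Fin (m + n)} (h : ¬ i.1 < m) :
    (pos i : Fin m ⊕ Fin n) = .inr ⟨i.1 - m, by omega⟩ := by
  rw [pos, Equiv.symm_apply_eq]
  ext
  simp
  omega

theorem pos_ne {i j : Fin (m + n)} (h : i.1 ≠ j.1) : (pos i : Fin m ⊕ Fin n) ≠ pos j :=
  fun e => h (congrArg Fin.val (pos_inj.1 e))

theorem raise_pow_even (i : Fin m) (k : ℕ) (t : Tuple m n) :
    (raise q (.inl i) ^ k) (Finsupp.single t 1) =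
      (∏ a ∈ Finset.range k, qInt q (t.1 i + a + 1)) •
        Finsupp.single (Function.update t.1 i (t.1 i + k), t.2) 1 := by
  induction k with
  | zero => simp
  | succ k ih =>
    rw [pow_succ', Module.End.mul_apply, ih, map_smul, raise_inl, smul_smul,
      Finset.prod_range_succ]
    simp [Nat.add_assoc]

section Scalars

variable {q}

theorem HasQChar.sub_ne (hq : HasQChar q ℓ) : q - q⁻¹ ≠ 0 := by
  intro h
  have h2 := hq.isLeast.2 (show (1 : ℕ) ∈ {k : ℕ | 0 < k ∧ qInt q k = 0} from
    ⟨one_pos, by simp [qInt, h]⟩)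
  have := hq.two_lt
  omega

theorem HasQChar.pow_eq (hq : HasQChar q ℓ) : q ^ ℓ = q⁻¹ ^ ℓ := by
  have h := hq.isLeast.1.2
  rw [qInt, div_eq_zero_iff] at h
  exact sub_eq_zero.1 (h.resolve_right hq.sub_ne)

theorem HasQChar.pow_two_mul (hq : HasQChar q ℓ) : q ^ (2 * ℓ) = 1 := by
  rw [two_mul, pow_add]
  nth_rewrite 1 [hq.pow_eq]
  rw [← mul_pow, inv_mul_cancel₀ hq.ne_zero, one_pow]

theorem HasQChar.qInt_mul (hq : HasQChar q ℓ) (c : ℕ) : qInt q (c * ℓ) = 0 := by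
  rw [qInt, mul_comm, pow_mul, pow_mul, hq.pow_eq, sub_self, zero_div]

theorem HasQChar.raise_pow (hq : HasQChar q ℓ) (p : Fin m ⊕ Fin n) : raise q p ^ ℓ = 0 := by
  have hl := hq.two_lt
  rcases p with i | i
  · apply end_ext
    intro t
    rw [raise_pow_even]
    have h : (t.1 i / ℓ + 1) * ℓ = t.1 i + (ℓ - 1 - t.1 i % ℓ) + 1 := by
      have h1 := Nat.div_add_mod (t.1 i) ℓ
      have h2 := Nat.mod_lt (t.1 i) (show 0 < ℓ by omega)
      rw [add_mul, one_mul, mul_comm]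
      omega
    rw [Finset.prod_eq_zero (i := ℓ - 1 - t.1 i % ℓ) (Finset.mem_range.2 (by omega))
      (by rw [← h]; exact hq.qInt_mul _)]
    simp
  · obtain ⟨k, rfl⟩ : ∃ k, ℓ = k + 2 := ⟨ℓ - 2, by omega⟩
    rw [pow_add, pow_two, raise_sq_odd, mul_zero]

end Scalars

/-- The action of the free algebra. -/
noncomputable def freeRep : Free F m n →ₐ[F] Module.End F (Tuple m n →₀ F) :=
  FreeAlgebra.lift F (genOp q)

theorem freeRep_e (j : Fin (m + n - 1)) :
    freeRep q (E F j) = raise q (pos (lo j)) * lower F (pos (hi j)) := by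
  simp [freeRep, genOp]

theorem freeRep_f (j : Fin (m + n - 1)) :
    freeRep q (Fe F j) = raise q (pos (hi j)) * lower F (pos (lo j)) := by
  simp [freeRep, genOp]

theorem freeRep_k (i : Fin (m + n)) : freeRep q (Kg F i) = diag (qAt q m i) (pos i) := by
  simp [freeRep, genOp]

theorem freeRep_kinv (i : Fin (m + n)) : freeRep q (Ki F i) = diag (qAt q m i)⁻¹ (pos i) := by
  simp [freeRep, genOp]

section Abstract

variable {V : Type*} [AddCommGroup V] [Module F V]

theorem comm_mul {r x y : Module.End F V} (hx : r * x = x * r) (hy : r * y = y * r) :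
    r * (x * y) = x * y * r := by
  rw [← mul_assoc, hx, mul_assoc, hy, mul_assoc]

theorem comm_step {r x y : Module.End F V} (hx : r * x = x * r) (hy : r * y = y * r) (c : F) :
    r * (x * y - c • (y * x)) = (x * y - c • (y * x)) * r := by
  rw [mul_sub, sub_mul, mul_smul_comm, smul_mul_assoc, comm_mul hx hy, comm_mul hy hx]

theorem step_e {r x e : Module.End F V} (he : r * e = e * r) (c : F) :
    r * x * e - c • (e * (r * x)) = r * (x * e - c • (e * x)) := by
  rw [mul_sub, mul_smul_comm, ← mul_assoc e, ← he, mul_assoc, mul_assoc]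

theorem step_f {r l x : Module.End F V} (hx : r * x = x * r) (c : F) :
    r * l * x - c • (x * (r * l)) = r * (l * x - c • (x * l)) := by
  rw [mul_sub, mul_smul_comm, ← mul_assoc x, ← hx, mul_assoc, mul_assoc]

theorem pow_zero_of_factor {r x : Module.End F V} {k : ℕ} (h : r * x = x * r) (hr : r ^ k = 0) :
    (r * x) ^ k = 0 := by
  rw [(show Commute r x from h).mul_pow, hr, zero_mul]

theorem word_ef {a b c d : Module.End F V} (hdb : d * b = b * d) (hdc : d * c = c * d) :
    a * b * (c * d) = a * d * (b * c) := by
  rw [mul_assoc, mul_assoc, ← mul_assoc d, hdb, mul_assoc, hdc]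

theorem word_comm {a b c d : Module.End F V} (hac : a * c = c * a) (had : a * d = d * a)
    (hbc : b * c = c * b) (hbd : b * d = d * b) : a * b * (c * d) = c * d * (a * b) := by
  have h1 : Commute a (c * d) := Commute.mul_right hac had
  have h2 : Commute b (c * d) := Commute.mul_right hbc hbd
  exact h1.mul_left h2

theorem word_sq {a b : Module.End F V} (h : a * b = b * a) (h0 : a * a = 0 ∨ b * b = 0) :
    a * b * (a * b) = 0 := by
  rw [mul_assoc, ← mul_assoc b, ← h, mul_assoc, ← mul_assoc, ← mul_assoc]
  rcases h0 with h0 | h0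
  · rw [h0, zero_mul, zero_mul]
  · rw [mul_assoc, h0, mul_zero]

end Abstract

theorem raise_comm_e {p : Fin m ⊕ Fin n} (j : Fin (m + n - 1)) (h : p ≠ pos (hi j)) :
    raise q p * freeRep q (E F j) = freeRep q (E F j) * raise q p := by
  rw [freeRep_e]
  exact comm_mul (raise_comm q _ _) (raise_lower_comm q h)

theorem raise_comm_f {p : Fin m ⊕ Fin n} (j : Fin (m + n - 1)) (h : p ≠ pos (lo j)) :
    raise q p * freeRep q (Fe F j) = freeRep q (Fe F j) * raise q p := by
  rw [freeRep_f]
  exact comm_mul (raise_comm q _ _) (raise_lower_comm q h)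

theorem freeRep_rootE (a d : ℕ) (h : a + d < m + n - 1) :
    ∃ X : Module.End F (Tuple m n →₀ F),
      raise q (pos ⟨a, by omega⟩) * X = X * raise q (pos ⟨a, by omega⟩) ∧
      freeRep q (rootE q a d h) = raise q (pos ⟨a, by omega⟩) * X := by
  induction d with
  | zero =>
    refine ⟨lower F (pos (hi ⟨a, h⟩)), raise_lower_comm q (pos_ne (by simp [hi])), ?_⟩
    rw [rootE, freeRep_e]
    rfl
  | succ d ih =>
    obtain ⟨X, hX, he⟩ := ih (by omega)
    have hc := raise_comm_e q (p := pos ⟨a, by omega⟩) ⟨a + (d + 1), h⟩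
      (pos_ne (by simp [hi]; omega))
    refine ⟨X * freeRep q (E F ⟨a + (d + 1), h⟩)
      - (qAt q m (a + (d + 1)))⁻¹ • (freeRep q (E F ⟨a + (d + 1), h⟩) * X),
      comm_step hX hc _, ?_⟩
    rw [rootE, map_sub, map_smul, map_mul, map_mul, he]
    exact step_e hc _

theorem freeRep_rootF (a d : ℕ) (h : a + d < m + n - 1) :
    (∀ k : Fin (m + n), a + d + 1 < k.1 →
      raise q (pos k) * freeRep q (rootF q a d h) = freeRep q (rootF q a d h) * raise q (pos k)) ∧
    ∃ X : Module.End F (Tuple m n →₀ F),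
      raise q (pos ⟨a + d + 1, by omega⟩) * X = X * raise q (pos ⟨a + d + 1, by omega⟩) ∧
      freeRep q (rootF q a d h) = raise q (pos ⟨a + d + 1, by omega⟩) * X := by
  induction d with
  | zero =>
    refine ⟨fun k hk => raise_comm_f q _ (pos_ne (by simp [lo]; omega)),
      lower F (pos (lo ⟨a, h⟩)), raise_lower_comm q (pos_ne (by simp [lo])), ?_⟩
    rw [rootF, freeRep_f]
    rfl
  | succ d ih =>
    obtain ⟨hF, -⟩ := ih (by omega)
    refine ⟨fun k hk => ?_, lower F (pos (lo ⟨a + (d + 1), h⟩)) * freeRep q (rootF q a d (by omega))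
      - qAt q m (a + (d + 1)) • (freeRep q (rootF q a d (by omega))
        * lower F (pos (lo ⟨a + (d + 1), h⟩))), ?_, ?_⟩
    · have h1 := hF k (by omega)
      have h2 := raise_comm_f q (p := pos k) ⟨a + (d + 1), h⟩ (pos_ne (by simp [lo]; omega))
      rw [rootF, map_sub, map_smul, map_mul, map_mul]
      exact comm_step h2 h1 _
    · have h1 := hF ⟨a + (d + 1) + 1, by omega⟩ (by simp)
      exact comm_step (raise_lower_comm q (r := pos (lo ⟨a + (d + 1), h⟩)) (pos_ne (by simp [lo]))) h1 _
    · have h1 := hF ⟨a + (d + 1) + 1, by omega⟩ (by simp)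
      rw [rootF, map_sub, map_smul, map_mul, map_mul, freeRep_f]
      exact step_f h1 _

theorem qInt_e_f {q : F} (hs : q - q⁻¹ ≠ 0) (a b : ℕ) :
    qInt q a * qInt q (b + 1) - qInt q b * qInt q (a + 1)
      = (q - q⁻¹)⁻¹ * (q ^ a * q⁻¹ ^ b - q⁻¹ ^ a * q ^ b) := by
  simp only [qInt, pow_succ]
  generalize q ^ a = x, q⁻¹ ^ a = x', q ^ b = y, q⁻¹ ^ b = y'
  rw [div_mul_div_comm, div_mul_div_comm, ← sub_div, div_eq_iff (mul_ne_zero hs hs)]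
  have : (q - q⁻¹)⁻¹ * (x * y' - x' * y) * ((q - q⁻¹) * (q - q⁻¹))
      = (x * y' - x' * y) * (q - q⁻¹) * ((q - q⁻¹)⁻¹ * (q - q⁻¹)) := by ring
  rw [this, inv_mul_cancel₀ hs]
  ring

theorem rel_e_f_self {q : F} (hs : q - q⁻¹ ≠ 0) (h0 : q ≠ 0) (i : Fin (m + n - 1)) :
    freeRep q (E F i * Fe F i - (-1 : F) ^ (parity m i * parity m i) • (Fe F i * E F i)) =
      freeRep q ((qAt q m i - (qAt q m i)⁻¹)⁻¹ •
          (Kg F (lo i) * Ki F (hi i) - Ki F (lo i) * Kg F (hi i))) := by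
  simp only [map_sub, map_smul, map_mul, freeRep_e, freeRep_f, freeRep_k, freeRep_kinv]
  have hne : (pos (lo i) : Fin m ⊕ Fin n) ≠ pos (hi i) := pos_ne (by simp [lo, hi])
  rw [word_ef (lower_comm _ _) (raise_lower_comm q hne.symm).symm,
    word_ef (lower_comm _ _) (raise_lower_comm q hne).symm]
  apply end_ext
  intro t
  have two : ∀ x : Fin 2, x = 0 ∨ x = 1 := by decide
  by_cases hhi : i.1 + 1 < m
  · have hlo : (lo i).1 < m := by simp [lo]; omega
    have hhi' : (hi i).1 < m := by simpa [hi] using hhi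
    simp only [pos_even hlo, pos_even hhi', parity, if_neg hhi.ne, qAt, if_pos hlo, if_pos hhi',
      if_pos (show i.1 < m by omega), LinearMap.sub_apply, LinearMap.smul_apply,
      Module.End.mul_apply, raise_lower_even, lower_raise_even, map_smul, diag_single, smul_smul,
      entry, Sum.elim_inl, smul_sub, mul_zero, pow_zero, one_mul, ← sub_smul]
    congr 1
    have := qInt_e_f hs (t.1 ⟨(lo i).1, hlo⟩) (t.1 ⟨(hi i).1, hhi'⟩)
    linear_combination this
  by_cases hm : i.1 + 1 = m
  · have hlo : (lo i).1 < m := by simp [lo]; omega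
    have hhi' : ¬ (hi i).1 < m := by simp [hi, hm]
    rcases two (t.2 ⟨(hi i).1 - m, by omega⟩) with h2 | h2 <;>
    simp only [pos_even hlo, pos_odd hhi', parity, if_pos hm, qAt, if_pos hlo, if_neg hhi',
      if_pos (show i.1 < m by omega), LinearMap.sub_apply, LinearMap.smul_apply, h2,
      Module.End.mul_apply, raise_lower_odd, lower_raise_odd, raise_lower_even, lower_raise_even,
      map_smul, diag_single, smul_smul, if_true, one_ne_zero, zero_ne_one, if_false, map_zero,
      smul_zero, sub_zero, zero_sub, Fin.val_zero, Fin.val_one, pow_zero, pow_one, mul_one, one_mul,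
      entry, Sum.elim_inl, Sum.elim_inr, inv_inv, smul_sub, ← sub_smul, ← neg_smul]
    · congr 1
      rw [qInt]
      ring
    · congr 1
      rw [qInt]
      ring
  · have hlo : ¬ (lo i).1 < m := by simp [lo]; omega
    have hhi' : ¬ (hi i).1 < m := by simp [hi]; omega
    have hs' : q⁻¹ - q ≠ 0 := by rw [← neg_sub]; exact neg_ne_zero.2 hs
    rcases two (t.2 ⟨(hi i).1 - m, by omega⟩) with h2 | h2 <;>
    rcases two (t.2 ⟨(lo i).1 - m, by omega⟩) with h3 | h3 <;>
    simp only [pos_odd hlo, pos_odd hhi', parity, if_neg hm, qAt, if_neg hlo, if_neg hhi',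
      if_neg (show ¬ i.1 < m by omega), LinearMap.sub_apply, LinearMap.smul_apply,
      Module.End.mul_apply, raise_lower_odd, lower_raise_odd, h2, h3, if_true, one_ne_zero,
      zero_ne_one, if_false, map_zero, smul_zero, sub_zero, zero_sub, Fin.val_zero, Fin.val_one,
      pow_one, mul_one, map_smul, diag_single, smul_smul, sub_self,
      entry, Sum.elim_inr, inv_inv, smul_sub, mul_zero, pow_zero, one_mul, one_smul, ← sub_smul]
    · rw [← mul_sub, inv_mul_cancel₀ hs', one_smul]
    · rw [← mul_sub, ← neg_sub q⁻¹ q, mul_neg, inv_mul_cancel₀ hs', neg_smul, one_smul]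
    · rw [inv_mul_cancel₀ h0, mul_inv_cancel₀ h0]
      simp

theorem raise_sq_of_odd {i : Fin (m + n)} (h : ¬ i.1 < m) :
    raise q (pos i) * raise q (pos i : Fin m ⊕ Fin n) = 0 := by
  rw [pos_odd h, raise_sq_odd]

theorem lower_sq_of_odd {i : Fin (m + n)} (h : ¬ i.1 < m) :
    lower F (pos i) * lower F (pos i : Fin m ⊕ Fin n) = 0 := by
  rw [pos_odd h, lower_sq_odd]

theorem mid_raise {q : F} (h0 : q ≠ 0) {i : Fin (m + n)} (h : i.1 < m) :
    raise q (pos i) * raise q (pos i) * lower F (pos i)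
      - (q + q⁻¹) • (raise q (pos i) * lower F (pos i) * raise q (pos i))
      + lower F (pos i) * raise q (pos i) * raise q (pos i : Fin m ⊕ Fin n) = 0 := by
  rw [pos_even h, ← osc_lrr h0]
  abel

theorem mid_lower {q : F} (h0 : q ≠ 0) {i : Fin (m + n)} (h : i.1 < m) :
    lower F (pos i) * lower F (pos i) * raise q (pos i)
      - (q + q⁻¹) • (lower F (pos i) * raise q (pos i) * lower F (pos i))
      + raise q (pos i) * lower F (pos i) * lower F (pos i : Fin m ⊕ Fin n) = 0 := by
  rw [pos_even h, ← osc_llr h0]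

theorem qAt_ne_zero {q : F} (h0 : q ≠ 0) (a b : ℕ) : qAt q a b ≠ 0 := by
  rw [qAt]
  split_ifs
  exacts [h0, inv_ne_zero h0]

theorem rel_k_e {c : F} (hc : c ≠ 0) (p r s : Fin m ⊕ Fin n) :
    diag c p * (raise q r * lower F s) =
      c ^ ((if p = r then 1 else 0) - (if p = s then 1 else 0) : ℤ) •
        (raise q r * lower F s * diag c p) := by
  rw [← mul_assoc, diag_mul_raise, smul_mul_assoc, mul_assoc, diag_mul_lower c hc, mul_smul_comm,
    smul_smul, ← zpow_add₀ hc, mul_assoc]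
  congr 2
  split_ifs <;> rfl

theorem rel_serre_e {q : F} (h0 : q ≠ 0) (i j : Fin (m + n - 1))
    (h : i.1 + 1 = j.1 ∨ j.1 + 1 = i.1) (him : i.1 + 1 ≠ m) :
    freeRep q (E F i * E F i * E F j - (q + q⁻¹) • (E F i * E F j * E F i)
      + E F j * E F i * E F i) = 0 := by
  simp only [map_sub, map_smul, map_mul, map_add, freeRep_e]
  have n1 : (pos (lo i) : Fin m ⊕ Fin n) ≠ pos (hi i) := pos_ne (by simp [lo, hi])
  have n2 : (pos (lo j) : Fin m ⊕ Fin n) ≠ pos (hi j) := pos_ne (by simp [lo, hi])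
  rcases h with h | h
  · have e : (lo j : Fin (m + n)) = hi i := Fin.ext (by simp [lo, hi, h])
    rw [e] at n2 ⊢
    refine word_serre (raise_lower_comm q n1).symm (raise_comm q _ _)
      (raise_lower_comm q (pos_ne (by simp [lo, hi]; omega))).symm (lower_comm _ _) _ ?_
    by_cases hm : (hi i : Fin (m + n)).1 < m
    · rw [mid_lower h0 hm, mul_zero]
    · rw [raise_sq_of_odd q (by simp [lo, hi] at *; omega), zero_mul]
  · have e : (hi j : Fin (m + n)) = lo i := Fin.ext (by simp [lo, hi, h])
    rw [e] at n2 ⊢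
    rw [raise_lower_comm q n1, raise_lower_comm q n2]
    refine word_serre (raise_lower_comm q n1) (lower_comm _ _)
      (raise_lower_comm q (pos_ne (by simp [lo, hi]; omega))) (raise_comm q _ _) _ ?_
    by_cases hm : (lo i : Fin (m + n)).1 < m
    · rw [mid_raise h0 hm, mul_zero]
    · rw [lower_sq_of_odd (by simp [lo, hi] at *; omega), zero_mul]

theorem rel_serre_f {q : F} (h0 : q ≠ 0) (i j : Fin (m + n - 1))
    (h : i.1 + 1 = j.1 ∨ j.1 + 1 = i.1) (him : i.1 + 1 ≠ m) :
    freeRep q (Fe F i * Fe F i * Fe F j - (q + q⁻¹) • (Fe F i * Fe F j * Fe F i)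
      + Fe F j * Fe F i * Fe F i) = 0 := by
  simp only [map_sub, map_smul, map_mul, map_add, freeRep_f]
  have n1 : (pos (hi i) : Fin m ⊕ Fin n) ≠ pos (lo i) := pos_ne (by simp [lo, hi])
  have n2 : (pos (hi j) : Fin m ⊕ Fin n) ≠ pos (lo j) := pos_ne (by simp [lo, hi])
  rcases h with h | h
  · have e : (lo j : Fin (m + n)) = hi i := Fin.ext (by simp [lo, hi, h])
    rw [e] at n2 ⊢
    rw [raise_lower_comm q n1, raise_lower_comm q n2]
    refine word_serre (raise_lower_comm q n1) (lower_comm _ _)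
      (raise_lower_comm q (pos_ne (by simp [lo, hi]; omega))) (raise_comm q _ _) _ ?_
    by_cases hm : (hi i : Fin (m + n)).1 < m
    · rw [mid_raise h0 hm, mul_zero]
    · rw [lower_sq_of_odd (by simp [lo, hi] at *; omega), zero_mul]
  · have e : (hi j : Fin (m + n)) = lo i := Fin.ext (by simp [lo, hi, h])
    rw [e] at n2 ⊢
    refine word_serre (raise_lower_comm q n1).symm (raise_comm q _ _)
      (raise_lower_comm q (pos_ne (by simp [lo, hi]; omega))).symm (lower_comm _ _) _ ?_
    by_cases hm : (lo i : Fin (m + n)).1 < m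
    · rw [mid_lower h0 hm, mul_zero]
    · rw [raise_sq_of_odd q (by simp [lo, hi] at *; omega), zero_mul]

theorem rel_super_e {q : F} (h0 : q ≠ 0) (a b c : Fin (m + n - 1)) (hb : b.1 + 1 = m)
    (hab : a.1 + 1 = b.1) (hbc : b.1 + 1 = c.1) :
    freeRep q (E F a * E F b * E F c * E F b + E F b * E F a * E F b * E F c
        + E F c * E F b * E F a * E F b + E F b * E F c * E F b * E F a
        - (q + q⁻¹) • (E F b * E F a * E F c * E F b)) = 0 := by
  simp only [map_sub, map_smul, map_mul, map_add, freeRep_e]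
  have e1 : (lo b : Fin (m + n)) = hi a := Fin.ext (by simp [lo, hi, hab])
  have e2 : (lo c : Fin (m + n)) = hi b := Fin.ext (by simp [lo, hi, hbc])
  rw [e1, e2]
  have n1 : (pos (lo a) : Fin m ⊕ Fin n) ≠ pos (hi a) := pos_ne (by simp [lo, hi])
  have n2 : (pos (lo a) : Fin m ⊕ Fin n) ≠ pos (hi b) := pos_ne (by simp [lo, hi]; omega)
  have n3 : (pos (lo a) : Fin m ⊕ Fin n) ≠ pos (hi c) := pos_ne (by simp [lo, hi]; omega)
  have n4 : (pos (hi a) : Fin m ⊕ Fin n) ≠ pos (hi b) := pos_ne (by simp [hi]; omega)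
  have n5 : (pos (hi a) : Fin m ⊕ Fin n) ≠ pos (hi c) := pos_ne (by simp [hi]; omega)
  have n6 : (pos (hi b) : Fin m ⊕ Fin n) ≠ pos (hi c) := pos_ne (by simp [hi]; omega)
  refine word_super (raise_lower_comm q n1).symm (raise_comm q _ _) (raise_lower_comm q n2).symm
    (raise_comm q _ _) (raise_lower_comm q n3).symm (lower_comm _ _)
    (raise_lower_comm q n4.symm) (lower_comm _ _) (raise_lower_comm q n4).symm (raise_comm q _ _)
    (raise_lower_comm q n5).symm (lower_comm _ _) (raise_lower_comm q n6).symm _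
    (lower_sq_of_odd (by simp [hi]; omega)) ?_
  rw [← mid_raise h0 (i := hi a) (by simp [hi]; omega)]
  abel

theorem rel_super_f {q : F} (h0 : q ≠ 0) (a b c : Fin (m + n - 1)) (hb : b.1 + 1 = m)
    (hab : a.1 + 1 = b.1) (hbc : b.1 + 1 = c.1) :
    freeRep q (Fe F a * Fe F b * Fe F c * Fe F b + Fe F b * Fe F a * Fe F b * Fe F c
        + Fe F c * Fe F b * Fe F a * Fe F b + Fe F b * Fe F c * Fe F b * Fe F a
        - (q + q⁻¹) • (Fe F b * Fe F a * Fe F c * Fe F b)) = 0 := by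
  simp only [map_sub, map_smul, map_mul, map_add, freeRep_f]
  have e1 : (lo b : Fin (m + n)) = hi a := Fin.ext (by simp [lo, hi, hab])
  have e2 : (lo c : Fin (m + n)) = hi b := Fin.ext (by simp [lo, hi, hbc])
  rw [e1, e2]
  have n1 : (pos (lo a) : Fin m ⊕ Fin n) ≠ pos (hi a) := pos_ne (by simp [lo, hi])
  have n2 : (pos (lo a) : Fin m ⊕ Fin n) ≠ pos (hi b) := pos_ne (by simp [lo, hi]; omega)
  have n3 : (pos (lo a) : Fin m ⊕ Fin n) ≠ pos (hi c) := pos_ne (by simp [lo, hi]; omega)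
  have n4 : (pos (hi a) : Fin m ⊕ Fin n) ≠ pos (hi b) := pos_ne (by simp [hi]; omega)
  have n5 : (pos (hi a) : Fin m ⊕ Fin n) ≠ pos (hi c) := pos_ne (by simp [hi]; omega)
  have n6 : (pos (hi b) : Fin m ⊕ Fin n) ≠ pos (hi c) := pos_ne (by simp [hi]; omega)
  rw [raise_lower_comm q n1.symm, raise_lower_comm q n4.symm, raise_lower_comm q n6.symm]
  refine word_super (raise_lower_comm q n1.symm) (lower_comm _ _) (raise_lower_comm q n2.symm)
    (lower_comm _ _) (raise_lower_comm q n3.symm) (raise_comm q _ _)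
    (raise_lower_comm q n4).symm (raise_comm q _ _) (raise_lower_comm q n4.symm) (lower_comm _ _)
    (raise_lower_comm q n5.symm) (raise_comm q _ _) (raise_lower_comm q n6.symm) _
    (raise_sq_of_odd q (by simp [hi]; omega)) ?_
  rw [← mid_lower h0 (i := hi a) (by simp [hi]; omega)]
  abel

/-- The operators satisfy the defining relations. -/
theorem freeRep_rel {q : F} (hq : HasQChar q ℓ) ⦃x y : Free F m n⦄ (h : Rel q ℓ m n x y) :
    freeRep q x = freeRep q y := by
  have h0 := hq.ne_zero
  induction h with
  | k_comm i j => simp only [map_mul, freeRep_k, diag_comm]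
  | k_kinv i =>
    rw [map_mul, map_one, freeRep_k, freeRep_kinv, diag_mul_inv _ (qAt_ne_zero h0 _ _)]
  | kinv_k i =>
    rw [map_mul, map_one, freeRep_k, freeRep_kinv, diag_comm, diag_mul_inv _ (qAt_ne_zero h0 _ _)]
  | k_e i j =>
    rw [map_smul, map_mul, map_mul, freeRep_k, freeRep_e, rel_k_e q (qAt_ne_zero h0 _ _)]
    simp only [pos_inj]
  | k_f i j =>
    rw [map_smul, map_mul, map_mul, freeRep_k, freeRep_f, rel_k_e q (qAt_ne_zero h0 _ _)]
    simp only [pos_inj]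
  | e_f_self i => exact rel_e_f_self hq.sub_ne h0 i
  | e_f_ne i j h =>
    have hv : i.1 ≠ j.1 := fun e => h (Fin.ext e)
    have hp : parity m i * parity m j = 0 := by
      simp only [parity]
      split_ifs <;> omega
    rw [hp, pow_zero, one_smul, map_zero, map_sub, map_mul, map_mul, freeRep_e, freeRep_f,
      sub_eq_zero]
    exact word_comm (raise_comm q _ _) (raise_lower_comm q (pos_ne (by simpa [lo] using hv)))
      (raise_lower_comm q (pos_ne (by simpa [hi] using hv.symm))).symm (lower_comm _ _)
  | e_e i j h =>
    rw [map_mul, map_mul, freeRep_e, freeRep_e]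
    exact word_comm (raise_comm q _ _) (raise_lower_comm q (pos_ne (by simp [lo, hi]; omega)))
      (raise_lower_comm q (pos_ne (by simp [lo, hi]; omega))).symm (lower_comm _ _)
  | f_f i j h =>
    rw [map_mul, map_mul, freeRep_f, freeRep_f]
    exact word_comm (raise_comm q _ _) (raise_lower_comm q (pos_ne (by simp [lo, hi]; omega)))
      (raise_lower_comm q (pos_ne (by simp [lo, hi]; omega))).symm (lower_comm _ _)
  | serre_e i j h him => rw [rel_serre_e h0 i j h him, map_zero]
  | serre_f i j h him => rw [rel_serre_f h0 i j h him, map_zero]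
  | e_odd b hb =>
    have n1 : (pos (lo b) : Fin m ⊕ Fin n) ≠ pos (hi b) := pos_ne (by simp [lo, hi])
    rw [map_mul, map_zero, freeRep_e]
    exact word_sq (raise_lower_comm q n1) (Or.inr (lower_sq_of_odd (by simp [hi]; omega)))
  | f_odd b hb =>
    have n1 : (pos (hi b) : Fin m ⊕ Fin n) ≠ pos (lo b) := pos_ne (by simp [lo, hi])
    rw [map_mul, map_zero, freeRep_f]
    exact word_sq (raise_lower_comm q n1) (Or.inl (raise_sq_of_odd q (by simp [hi]; omega)))
  | super_e a b c hb hab hbc => rw [rel_super_e h0 a b c hb hab hbc, map_zero]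
  | super_f a b c hb hab hbc => rw [rel_super_f h0 a b c hb hab hbc, map_zero]
  | rootE_pow a d h hev =>
    obtain ⟨X, hX, he⟩ := freeRep_rootE q a d h
    rw [map_pow, map_zero, he]
    exact pow_zero_of_factor hX (hq.raise_pow _)
  | rootF_pow a d h hev =>
    obtain ⟨-, X, hX, he⟩ := freeRep_rootF q a d h
    rw [map_pow, map_zero, he]
    exact pow_zero_of_factor hX (hq.raise_pow _)
  | k_pow i =>
    rw [map_pow, map_one, freeRep_k, diag_pow]
    have : qAt q m i ^ (2 * ℓ) = 1 := by
      rw [qAt]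
      split_ifs
      · exact hq.pow_two_mul
      · rw [inv_pow, hq.pow_two_mul, inv_one]
    rw [this]
    apply end_ext
    intro t
    simp [diag_single]

end Operators

section Module

variable {F : Type*} [Field F] {q : F} {ℓ : ℕ}

/-- The action of `u_q(gl(m|n))` on the span of the monomials. -/
noncomputable def rep (hq : HasQChar q ℓ) (m n : ℕ) :
    SmallQ q ℓ m n →ₐ[F] Module.End F (Tuple m n →₀ F) :=
  RingQuot.liftAlgHom F ⟨freeRep q, freeRep_rel hq⟩

/-- The quantum Grassmann superalgebra `Ω_q(m|n)` (its underlying vector space, with basis the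
monomials `x^⟨α,μ⟩ = x^(α) ⊗ x^μ`). -/
def Omega (_ : HasQChar q ℓ) (m n : ℕ) : Type _ := Tuple m n →₀ F

variable (hq : HasQChar q ℓ) (m n : ℕ)

noncomputable instance : AddCommGroup (Omega hq m n) :=
  inferInstanceAs (AddCommGroup (Tuple m n →₀ F))

noncomputable instance : Module F (Omega hq m n) :=
  inferInstanceAs (Module F (Tuple m n →₀ F))

/-- `Ω_q(m|n)` as a module over `u_q(gl(m|n))`. -/
noncomputable instance : Module (SmallQ q ℓ m n) (Omega hq m n) :=
  Module.compHom (Tuple m n →₀ F) (rep hq m n).toRingHom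

variable {m n}

/-- The monomial `x^⟨α,μ⟩`. -/
noncomputable def mono (t : Tuple m n) : Omega hq m n := Finsupp.single t 1

theorem smul_def (u : SmallQ q ℓ m n) (v : Omega hq m n) :
    u • v = rep hq m n u v := rfl

variable (m n)

/-- `ℤ₊^m × ℤ₂^n(s)`. -/
def tuples (m n s : ℕ) : Set (Tuple m n) := {t | t.deg = s}

/-- `ℤ₊^m × ℤ₂^n(s, 𝐫)`, where `𝐫 = (rℓ - 1, …, rℓ - 1)`. -/
def truncTuples (m n s ℓ r : ℕ) : Set (Tuple m n) := {t | t.deg = s ∧ ∀ i, t.1 i ≤ r * ℓ - 1}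


variable {m n}

theorem lower_bound (r : Fin m ⊕ Fin n) (t : Tuple m n) :
    lower F r (Finsupp.single t 1) = 0 ∨ ∃ t' : Tuple m n,
      lower F r (Finsupp.single t 1) = Finsupp.single t' 1 ∧ t'.deg + 1 = t.deg ∧
        ∀ i, t'.1 i ≤ t.1 i := by
  rcases r with i | k
  · rw [lower_inl]
    by_cases h : t.1 i = 0
    · exact Or.inl (if_pos h)
    refine Or.inr ⟨_, if_neg h, ?_, fun j => ?_⟩
    · simp only [Tuple.deg]
      rw [Finset.sum_update_of_mem (Finset.mem_univ i),
        ← Finset.add_sum_erase _ t.1 (Finset.mem_univ i), Finset.sdiff_singleton_eq_erase]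
      omega
    · by_cases hj : j = i
      · subst hj
        simp
      · simp [Function.update_of_ne hj]
  · rw [lower_inr]
    by_cases h : t.2 k = 1
    · refine Or.inr ⟨_, if_pos h, ?_, fun j => le_rfl⟩
      simp only [Tuple.deg]
      rw [← Finset.add_sum_erase _ (fun k => (t.2 k : ℕ)) (Finset.mem_univ k),
        ← Finset.add_sum_erase _ (fun j => ((Function.update t.2 k 0 j : Fin 2) : ℕ))
          (Finset.mem_univ k),
        Finset.sum_congr rfl (g := fun j => (t.2 j : ℕ)) (fun j hj => by
          rw [Function.update_of_ne (Finset.ne_of_mem_erase hj)])]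
      simp [h]
      omega
    · exact Or.inl (if_neg h)

theorem raise_bound (hq : HasQChar q ℓ) (r : Fin m ⊕ Fin n) (t : Tuple m n) :
    raise q r (Finsupp.single t 1) = 0 ∨ ∃ (t' : Tuple m n) (c : F),
      raise q r (Finsupp.single t 1) = c • Finsupp.single t' 1 ∧ t'.deg = t.deg + 1 ∧
        ∀ k : ℕ, 0 < k → (∀ i, t.1 i ≤ k * ℓ - 1) → ∀ i, t'.1 i ≤ k * ℓ - 1 := by
  have hl := hq.two_lt
  rcases r with i | k
  · rw [raise_inl]
    by_cases h : qInt q (t.1 i + 1) = 0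
    · exact Or.inl (by rw [h, zero_smul])
    refine Or.inr ⟨_, _, rfl, ?_, fun k hk hb j => ?_⟩
    · simp only [Tuple.deg]
      rw [Finset.sum_update_of_mem (Finset.mem_univ i),
        ← Finset.add_sum_erase _ t.1 (Finset.mem_univ i), Finset.sdiff_singleton_eq_erase]
      omega
    · by_cases hj : j = i
      · subst hj
        have h1 : 0 < k * ℓ := Nat.mul_pos hk (by omega)
        have h2 : t.1 j + 1 ≠ k * ℓ := fun e => h (by rw [e]; exact hq.qInt_mul k)
        have h3 := hb j
        simp only [Function.update_self]
        omega
      · simpa [Function.update_of_ne hj] using hb j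
  · rw [raise_inr]
    by_cases h : t.2 k = 0
    · refine Or.inr ⟨(t.1, Function.update t.2 k 1), 1, by rw [if_pos h, one_smul], ?_,
        fun k hk hb j => hb j⟩
      simp only [Tuple.deg]
      rw [← Finset.add_sum_erase _ (fun k => (t.2 k : ℕ)) (Finset.mem_univ k),
        ← Finset.add_sum_erase _ (fun j => ((Function.update t.2 k 1 j : Fin 2) : ℕ))
          (Finset.mem_univ k),
        Finset.sum_congr rfl (g := fun j => (t.2 j : ℕ)) (fun j hj => by
          rw [Function.update_of_ne (Finset.ne_of_mem_erase hj)])]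
      simp [h]
      omega
    · exact Or.inl (if_neg h)

theorem genOp_bound (hq : HasQChar q ℓ) (g : Gen m n) (t : Tuple m n) :
    ∃ (t' : Tuple m n) (c : F), genOp q g (Finsupp.single t 1) = c • Finsupp.single t' 1 ∧
      t'.deg = t.deg ∧
        ∀ k : ℕ, 0 < k → (∀ i, t.1 i ≤ k * ℓ - 1) → ∀ i, t'.1 i ≤ k * ℓ - 1 := by
  have key : ∀ p r : Fin m ⊕ Fin n, ∃ (t' : Tuple m n) (c : F),
      (raise q p * lower F r) (Finsupp.single t 1) = c • Finsupp.single t' 1 ∧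
      t'.deg = t.deg ∧
        ∀ k : ℕ, 0 < k → (∀ i, t.1 i ≤ k * ℓ - 1) → ∀ i, t'.1 i ≤ k * ℓ - 1 := by
    intro p r
    rw [Module.End.mul_apply]
    rcases lower_bound (F := F) r t with h | ⟨t1, h1, h2, h3⟩
    · exact ⟨t, 0, by rw [h, map_zero, zero_smul], rfl, fun _ _ h => h⟩
    rw [h1]
    rcases raise_bound hq p t1 with h | ⟨t2, c, e1, e2, e3⟩
    · exact ⟨t, 0, by rw [h, zero_smul], rfl, fun _ _ h => h⟩
    · exact ⟨t2, c, e1, by omega, fun k hk hb => e3 k hk fun i => (h3 i).trans (hb i)⟩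
  cases g with
  | e j => exact key _ _
  | f j => exact key _ _
  | k i => exact ⟨t, _, diag_single _ _ _, rfl, fun _ _ h => h⟩
  | kinv i => exact ⟨t, _, diag_single _ _ _, rfl, fun _ _ h => h⟩

theorem smul_mem_span (S : Set (Tuple m n))
    (hS : ∀ (g : Gen m n) (t : Tuple m n), t ∈ S → ∃ t' ∈ S, ∃ c : F,
      genOp q g (Finsupp.single t 1) = c • Finsupp.single t' 1)
    (u : SmallQ q ℓ m n) (v : Omega hq m n) (hv : v ∈ Submodule.span F (mono hq '' S)) :
    u • v ∈ Submodule.span F (mono hq '' S) := by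
  obtain ⟨x, rfl⟩ := RingQuot.mkAlgHom_surjective F (Rel q ℓ m n) u
  have hx : ∀ v : Omega hq m n, (RingQuot.mkAlgHom F (Rel q ℓ m n) x) • v =
      (freeRep q x v : Tuple m n →₀ F) := by
    intro v
    rw [smul_def, rep, RingQuot.liftAlgHom_mkAlgHom_apply]
  rw [hx]
  clear hx
  induction x using FreeAlgebra.induction generalizing v with
  | grade0 c =>
    rw [AlgHom.commutes]
    exact Submodule.smul_mem _ c hv
  | grade1 g =>
    rw [freeRep, FreeAlgebra.lift_ι_apply]
    induction hv using Submodule.span_induction with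
    | mem y hy =>
      obtain ⟨t, ht, rfl⟩ := hy
      obtain ⟨t', ht', c, h⟩ := hS g t ht
      have : (genOp q g (mono hq t) : Omega hq m n) = c • mono hq t' := h
      rw [this]
      exact Submodule.smul_mem _ _ (Submodule.subset_span ⟨t', ht', rfl⟩)
    | zero =>
      have : (genOp q g (0 : Omega hq m n) : Omega hq m n) = 0 := map_zero (genOp q g)
      rw [this]
      exact Submodule.zero_mem _
    | add y z _ _ h1 h2 =>
      have : (genOp q g (y + z) : Omega hq m n) = genOp q g y + genOp q g z :=
        map_add (genOp q g) y z
      rw [this]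
      exact Submodule.add_mem _ h1 h2
    | smul c y _ h1 =>
      have : (genOp q g (c • y) : Omega hq m n) = c • genOp q g y := map_smul (genOp q g) c y
      rw [this]
      exact Submodule.smul_mem _ _ h1
  | mul a b ha hb =>
    rw [map_mul]
    exact ha _ (hb _ hv)
  | add a b ha hb =>
    rw [map_add]
    exact Submodule.add_mem _ (ha _ hv) (hb _ hv)

variable (m n)

/-- The `u_q(gl(m|n))`-submodule `Ω_q^(s)(m|n)` of `Ω_q(m|n)`: the linear span of the monomials of
degree `s`. -/
noncomputable def OmegaDeg (s : ℕ) : Submodule (SmallQ q ℓ m n) (Omega hq m n) where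
  carrier := Submodule.span F (mono hq '' tuples m n s)
  add_mem' := Submodule.add_mem _
  zero_mem' := Submodule.zero_mem _
  smul_mem' u v hv := smul_mem_span hq _ (fun g t ht => by
    obtain ⟨t', c, h1, h2, -⟩ := genOp_bound hq g t
    exact ⟨t', h2.trans ht, c, h1⟩) u v hv

/-- The `u_q(gl(m|n))`-submodule `Ω_q^(s)(m|n, 𝐫)` of `Ω_q(m|n)`: the linear span of the monomials
of degree `s` with `α_i ≤ rℓ - 1` for all `i`. -/
noncomputable def OmegaTrunc (s r : ℕ) (hr : 0 < r) :
    Submodule (SmallQ q ℓ m n) (Omega hq m n) where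
  carrier := Submodule.span F (mono hq '' truncTuples m n s ℓ r)
  add_mem' := Submodule.add_mem _
  zero_mem' := Submodule.zero_mem _
  smul_mem' u v hv := smul_mem_span hq _ (fun g t ht => by
    obtain ⟨t', c, h1, h2, h3⟩ := genOp_bound hq g t
    exact ⟨t', ⟨h2.trans ht.1, h3 r hr ht.2⟩, c, h1⟩) u v hv

variable {m n}

/-- The monomial `x^⟨α,μ⟩` as an element of `Ω_q^(s)(m|n)`. -/
noncomputable def monoDeg {s : ℕ} (t : tuples m n s) : OmegaDeg hq m n s :=
  ⟨mono hq t.1, Submodule.subset_span ⟨t.1, t.2, rfl⟩⟩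

/-- The monomial `x^⟨α,μ⟩` as an element of `Ω_q^(s)(m|n, 𝐫)`. -/
noncomputable def monoTrunc {s r : ℕ} (hr : 0 < r) (t : truncTuples m n s ℓ r) :
    OmegaTrunc hq m n s r hr :=
  ⟨mono hq t.1, Submodule.subset_span ⟨t.1, t.2, rfl⟩⟩

end Module

/-! ### Cyclic submodules and heads -/

section Head

variable {R M : Type*} [Ring R] [AddCommGroup M] [Module R M]

/-- The cyclic submodule `R . x`. -/
abbrev cyclic (R : Type*) {M : Type*} [Ring R] [AddCommGroup M] [Module R M] (x : M) :
    Submodule R M :=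
  Submodule.span R {x}

/-- The radical of a submodule `V` (the intersection of its maximal submodules), as a submodule
of the ambient module. -/
def radical (V : Submodule R M) : Submodule R M := (Module.jacobson R V).map V.subtype

/-- The head `V / Rad V`. -/
abbrev Head (V : Submodule R M) : Type _ := V ⧸ Module.jacobson R V

/-- The natural map from the head of `V` to `M / N`, where `N` contains the radical of `V`. -/
def headMap (V N : Submodule R M) (h : radical V ≤ N) : Head V →ₗ[R] M ⧸ N :=
  Submodule.mapQ _ _ V.subtype (Submodule.map_le_iff_le_comap.1 h)

/-- `Hd(V) ∩ Hd(W) = 0` for two submodules `V`, `W` of `M`: in `M / (Rad V + Rad W)`, which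
contains both heads, these have zero intersection. -/
def HeadsMeetTrivially (V W : Submodule R M) : Prop :=
  Function.Injective (headMap V (radical V ⊔ radical W) le_sup_left) ∧
  Function.Injective (headMap W (radical V ⊔ radical W) le_sup_right) ∧
  LinearMap.range (headMap V (radical V ⊔ radical W) le_sup_left) ⊓
    LinearMap.range (headMap W (radical V ⊔ radical W) le_sup_right) = ⊥

end Head

end QGrass

/-! The whole theorem rests on one criterion, `reaches_iff`: the monomial of `b` lies in the
submodule generated by the monomial of `a` exactly when `a` and `b` have the same degree and the
energy of `b` is componentwise at most that of `a`.

Necessity comes from the coefficients. Every generator sends a monomial to a multiple of a monomial.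
Increasing an even entry `α` costs the factor `[α + 1]`, which vanishes precisely when `ℓ ∣ α + 1`,
that is, when `⌊α / ℓ⌋` would grow. Hence the energy can never increase (`genOp_energy_le`,
`coeff_smul_mono_ne_zero`). Sufficiency is a transport argument: single units are moved from
positions where `a` exceeds `b` to positions where it falls short. The energy condition guarantees
that the receiving entry is never blocked, and a move between distant positions decomposes into
adjacent ones, which are generators up to nonzero scalars (`reaches_of_isShift`). Claims (i) and
(ii) follow at once.

For (iii), let `V` and `W` be generated by the monomials of `a` and `b`. Equal total energies and
distinct energies make the energies incomparable, so the monomial of `a` has coefficient `0` in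
every `w ∈ V ∩ W`, and coefficient `1` in `x - w`, where `x` is that monomial. Among the monomials
that occur in `V`, the one of `a` is alone in its weight (`eq_of_weight_eq`): the weight fixes all
entries modulo `ℓ`, and degree and energy fix the rest. So a polynomial in the `K_i` recovers `x`
from `x - w` (`exists_smul_eq_mono`). Thus `x - w` generates `V` for every such `w`, which forces `V
∩ W` into `Rad V`, and symmetrically into `Rad W`; the statement on heads is then pure module theory
(`headsMeetTrivially_of_inf_le`). -/

namespace QGrass

/-! ### Vanishing of quantum integers and powers of `q` modulo `ℓ`. -/

section Scalars

variable {F : Type*} [Field F] {q : F} {ℓ : ℕ}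

theorem qInt_eq_zero_iff_pow (hq : HasQChar q ℓ) (k : ℕ) : qInt q k = 0 ↔ q ^ (2 * k) = 1 := by
  have h0 := pow_ne_zero k hq.ne_zero
  rw [qInt, div_eq_zero_iff, or_iff_left hq.sub_ne, sub_eq_zero, inv_pow, two_mul, pow_add,
    mul_eq_one_iff_eq_inv₀ h0]

/-- Vanishing of `[k]` depends only on `q ^ (2 * k)`. Since `q ^ (2 * ℓ) = 1`, it passes to the
remainder of `k` modulo `ℓ`, where minimality of `ℓ` applies. -/
theorem qInt_eq_zero_iff (hq : HasQChar q ℓ) (k : ℕ) : qInt q k = 0 ↔ ℓ ∣ k := by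
  constructor
  · intro h
    by_contra hk
    have hl := hq.two_lt
    have h1 : 0 < k % ℓ := Nat.pos_of_ne_zero fun e => hk (Nat.dvd_of_mod_eq_zero e)
    have h2 : qInt q (k % ℓ) = 0 := by
      rw [qInt_eq_zero_iff_pow hq] at h ⊢
      rw [← Nat.div_add_mod k ℓ, mul_add, pow_add, ← mul_assoc, pow_mul, hq.pow_two_mul, one_pow,
        one_mul] at h
      exact h
    exact absurd (hq.isLeast.2 ⟨h1, h2⟩) (not_le.2 (Nat.mod_lt k (by omega)))
  · rintro ⟨c, rfl⟩
    rw [mul_comm]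
    exact hq.qInt_mul c

/-- The eigenvalues of the `K_i` therefore determine the entries of a tuple modulo `ℓ`. Only this
direction holds in general, because `q` may have order `2 * ℓ`. -/
theorem modEq_of_pow_eq (hq : HasQChar q ℓ) {a b : ℕ} (h : q ^ a = q ^ b) : a ≡ b [MOD ℓ] := by
  wlog hab : a ≤ b generalizing a b
  · exact (this h.symm (by omega)).symm
  rw [Nat.modEq_iff_dvd' hab, ← qInt_eq_zero_iff hq, qInt_eq_zero_iff_pow hq, mul_comm, pow_mul]
  have : q ^ (b - a) = 1 := by
    have h1 : q ^ a * q ^ (b - a) = q ^ a * 1 := by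
      rw [← pow_add, Nat.add_sub_cancel' hab, mul_one, h]
    exact mul_left_cancel₀ (pow_ne_zero a hq.ne_zero) h1
  rw [this, one_pow]

end Scalars

/-! ### Entries of tuples and the transfer of one unit. -/

section Tuples

variable {m n : ℕ}

theorem entry_inl (i : Fin m) (t : Tuple m n) : entry (.inl i) t = t.1 i := rfl

theorem entry_inr (k : Fin n) (t : Tuple m n) : entry (.inr k) t = (t.2 k : ℕ) := rfl

theorem tuple_ext {t t' : Tuple m n} (h : ∀ p, entry p t = entry p t') : t = t' :=
  Prod.ext (funext fun i => h (.inl i)) (funext fun k => Fin.ext (h (.inr k)))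

theorem deg_eq_sum_entry (t : Tuple m n) : t.deg = ∑ p, entry p t := by
  simp [Tuple.deg, Fintype.sum_sum_type, entry]

theorem exists_tuple_entry_eq (c : Fin m ⊕ Fin n → ℕ) (hc : ∀ k, c (.inr k) ≤ 1) :
    ∃ t : Tuple m n, ∀ p, entry p t = c p := by
  refine ⟨(fun i => c (.inl i), fun k => ⟨c (.inr k), by have := hc k; omega⟩), ?_⟩
  rintro (i | k) <;> rfl

/-- The entry at the position `p` can be increased by a generator without changing the energy. -/
def HasRoom (ℓ : ℕ) (t : Tuple m n) : Fin m ⊕ Fin n → Prop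
  | .inl i => ¬ ℓ ∣ t.1 i + 1
  | .inr k => t.2 k = 0

theorem hasRoom_congr {ℓ : ℕ} {t t' : Tuple m n} {p : Fin m ⊕ Fin n}
    (h : entry p t' = entry p t) : HasRoom ℓ t' p ↔ HasRoom ℓ t p := by
  rcases p with i | k
  · simp only [entry_inl] at h
    simp [HasRoom, h]
  · have : t'.2 k = t.2 k := Fin.ext h
    simp [HasRoom, this]

/-- This and `hasRoom_of_entry_add_one` deal with a blocked intermediate position: it has a unit to
give away, and once it has done so it can receive one, since `ℓ` cannot divide two consecutive
integers. -/
theorem entry_pos_of_not_hasRoom {ℓ : ℕ} (hl : 2 < ℓ) {t : Tuple m n} {p : Fin m ⊕ Fin n}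
    (h : ¬ HasRoom ℓ t p) : 0 < entry p t := by
  rcases p with i | k
  · rw [entry_inl]
    by_contra h0
    rw [HasRoom, not_not] at h
    have := Nat.le_of_dvd (by omega) h
    omega
  · rw [entry_inr]
    by_contra h0
    exact h (Fin.ext (by simpa using h0))

theorem hasRoom_of_entry_add_one {ℓ : ℕ} (hl : 2 < ℓ) {t t' : Tuple m n} {p : Fin m ⊕ Fin n}
    (h : ¬ HasRoom ℓ t p) (he : entry p t' + 1 = entry p t) : HasRoom ℓ t' p := by
  rcases p with i | k
  · simp only [entry_inl] at he
    rw [HasRoom, not_not] at h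
    rw [HasRoom, he]
    intro h1
    have := Nat.le_of_dvd one_pos ((Nat.dvd_add_right h1).1 h)
    omega
  · simp only [entry_inr] at he
    have := (t.2 k).isLt
    exact Fin.ext (by simp; omega)

/-- `t'` arises from `t` by moving one unit from the position `p` to the position `r`. -/
structure IsShift (p r : Fin m ⊕ Fin n) (t t' : Tuple m n) : Prop where
  source : entry p t' + 1 = entry p t
  target : entry r t' = entry r t + 1
  other : ∀ x, x ≠ p → x ≠ r → entry x t' = entry x t

theorem exists_isShift {ℓ : ℕ} {p r : Fin m ⊕ Fin n} {t : Tuple m n} (hpr : p ≠ r)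
    (hp : 0 < entry p t) (hr : HasRoom ℓ t r) : ∃ t', IsShift p r t t' := by
  obtain ⟨t', ht⟩ := exists_tuple_entry_eq
    -- The bound `1` at odd positions has to be checked: at `r` it holds because room at an odd
    -- position means that the entry is `0`.
    (fun x => if x = p then entry p t - 1 else if x = r then entry r t + 1 else entry x t) (by
      intro k
      have h1 : entry (.inr k) t ≤ 1 := by
        rw [entry_inr]
        omega
      split_ifs with h2 h3
      · rw [← h2]
        omega
      · rw [← h3] at hr ⊢
        rw [HasRoom] at hr
        simp [entry_inr, hr]
      · exact h1)
  refine ⟨t', ?_, ?_, fun x h1 h2 => ?_⟩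
  · rw [ht, if_pos rfl]
    omega
  · rw [ht, if_neg hpr.symm, if_pos rfl]
  · rw [ht, if_neg h1, if_neg h2]

end Tuples

/-! ### Raising and lowering operators, energy and weights. -/

section Operators

variable {F : Type*} [Field F] {q : F} {ℓ m n : ℕ}

theorem lower_eq_single {p : Fin m ⊕ Fin n} {t t' : Tuple m n} (hp : entry p t' + 1 = entry p t)
    (ho : ∀ x, x ≠ p → entry x t' = entry x t) :
    lower F p (Finsupp.single t 1) = Finsupp.single t' 1 := by
  rcases p with i | k
  · rw [entry_inl, entry_inl] at hp
    rw [lower_inl, if_neg (by omega)]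
    congr 1
    apply tuple_ext
    intro x
    by_cases hx : x = .inl i
    · subst hx
      simp only [entry_inl, Function.update_self]
      omega
    · rw [ho x hx]
      rcases x with j | j
      · have : j ≠ i := fun e => hx (by rw [e])
        simp [entry_inl, Function.update_of_ne this]
      · rfl
  · rw [entry_inr, entry_inr] at hp
    have h1 := (t.2 k).isLt
    rw [lower_inr, if_pos (Fin.ext (by simp; omega))]
    congr 1
    apply tuple_ext
    intro x
    by_cases hx : x = .inr k
    · subst hx
      simp only [entry_inr, Function.update_self, Fin.val_zero]
      omega
    · rw [ho x hx]
      rcases x with j | j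
      · rfl
      · have : j ≠ k := fun e => hx (by rw [e])
        simp [entry_inr, Function.update_of_ne this]

theorem raise_eq_smul_single (hq : HasQChar q ℓ) {p : Fin m ⊕ Fin n} {t t' : Tuple m n}
    (hr : HasRoom ℓ t p) (hp : entry p t' = entry p t + 1)
    (ho : ∀ x, x ≠ p → entry x t' = entry x t) :
    ∃ c : F, c ≠ 0 ∧ raise q p (Finsupp.single t 1) = c • Finsupp.single t' 1 := by
  rcases p with i | k
  · rw [entry_inl, entry_inl] at hp
    refine ⟨_, fun h => hr ((qInt_eq_zero_iff hq _).1 h), ?_⟩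
    rw [raise_inl]
    congr 2
    apply tuple_ext
    intro x
    by_cases hx : x = .inl i
    · subst hx
      simp only [entry_inl, Function.update_self]
      omega
    · rw [ho x hx]
      rcases x with j | j
      · have : j ≠ i := fun e => hx (by rw [e])
        simp [entry_inl, Function.update_of_ne this]
      · rfl
  · rw [entry_inr, entry_inr] at hp
    refine ⟨1, one_ne_zero, ?_⟩
    rw [HasRoom] at hr
    rw [raise_inr, if_pos hr, one_smul]
    congr 1
    apply tuple_ext
    intro x
    by_cases hx : x = .inr k
    · subst hx
      simp only [entry_inr, Function.update_self, hp, hr]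
      simp
    · rw [ho x hx]
      rcases x with j | j
      · rfl
      · have : j ≠ k := fun e => hx (by rw [e])
        simp [entry_inr, Function.update_of_ne this]

theorem raise_mul_lower_eq_smul_single (hq : HasQChar q ℓ) {p r : Fin m ⊕ Fin n} (hpr : p ≠ r)
    {t t' : Tuple m n} (hr : HasRoom ℓ t r) (h : IsShift p r t t') :
    ∃ c : F, c ≠ 0 ∧
      (raise q r * lower F p) (Finsupp.single t 1) = c • Finsupp.single t' 1 := by
  -- `t1` is the intermediate tuple of degree one less: the unit has left `p` and has not yet
  -- arrived at `r`.
  obtain ⟨t1, h1⟩ := exists_tuple_entry_eq (Function.update (fun x => entry x t) p (entry p t'))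
    (by
      intro k
      by_cases hk : .inr k = p
      · subst hk
        rw [Function.update_self, entry_inr]
        omega
      · rw [Function.update_of_ne hk, entry_inr]
        omega)
  have hp1 : entry p t1 = entry p t' := by rw [h1, Function.update_self]
  have ho1 : ∀ x, x ≠ p → entry x t1 = entry x t := fun x hx => by
    rw [h1, Function.update_of_ne hx]
  rw [Module.End.mul_apply, lower_eq_single (t' := t1) (by rw [hp1, h.source]) ho1]
  refine raise_eq_smul_single hq ((hasRoom_congr (ho1 r hpr.symm)).2 hr)
    (by rw [ho1 r hpr.symm, h.target]) fun x hx => ?_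
  by_cases hxp : x = p
  · rw [hxp, hp1]
  · rw [ho1 x hxp, h.other x hxp hx]

/-- The quotient `⌊α / ℓ⌋` grows under `α ↦ α + 1` only if `ℓ ∣ α + 1`, and then the coefficient `[α
+ 1]` is zero. Odd entries do not enter the energy. -/
theorem raise_energy_le (hq : HasQChar q ℓ) (r : Fin m ⊕ Fin n) (t : Tuple m n) :
    raise q r (Finsupp.single t 1) = 0 ∨ ∃ (t' : Tuple m n) (c : F),
      raise q r (Finsupp.single t 1) = c • Finsupp.single t' 1 ∧ t'.deg = t.deg + 1 ∧
        t'.energy ℓ ≤ t.energy ℓ := by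
  rcases r with i | k
  · rw [raise_inl]
    by_cases h : qInt q (t.1 i + 1) = 0
    · exact Or.inl (by rw [h, zero_smul])
    refine Or.inr ⟨_, _, rfl, ?_, fun j => ?_⟩
    · simp only [Tuple.deg]
      rw [Finset.sum_update_of_mem (Finset.mem_univ i),
        ← Finset.add_sum_erase _ t.1 (Finset.mem_univ i), Finset.sdiff_singleton_eq_erase]
      omega
    · simp only [Tuple.energy]
      by_cases hj : j = i
      · subst hj
        rw [qInt_eq_zero_iff hq] at h
        rw [Function.update_self, Nat.succ_div_of_not_dvd h]
      · rw [Function.update_of_ne hj]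
  -- `raise_bound` already gives the degree. Its `t'` has to be identified with the explicit result
  -- in order to see that the even part is unchanged; for this `c = 0` must be treated apart.
  · rcases raise_bound hq (.inr k) t with h | ⟨t', c, h1, h2, -⟩
    · exact Or.inl h
    rw [raise_inr] at h1 ⊢
    by_cases h : t.2 k = 0
    · rw [if_pos h] at h1 ⊢
      by_cases hc : c = 0
      · rw [hc, zero_smul] at h1
        exact Or.inl h1
      have e : (t.1, Function.update t.2 k 1) = t' := by
        rw [Finsupp.smul_single, smul_eq_mul, mul_one] at h1
        rcases (Finsupp.single_eq_single_iff _ _ _ _).1 h1 with h | h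
        · exact h.1
        · exact absurd h.1 one_ne_zero
      refine Or.inr ⟨t', 1, by rw [e, one_smul], h2, ?_⟩
      rw [← e]
      exact le_rfl
    · exact Or.inl (if_neg h)

theorem genOp_energy_le (hq : HasQChar q ℓ) (g : Gen m n) (t : Tuple m n) :
    ∃ (t' : Tuple m n) (c : F), genOp q g (Finsupp.single t 1) = c • Finsupp.single t' 1 ∧
      t'.deg = t.deg ∧ t'.energy ℓ ≤ t.energy ℓ := by
  have key : ∀ p r : Fin m ⊕ Fin n, ∃ (t' : Tuple m n) (c : F),
      (raise q p * lower F r) (Finsupp.single t 1) = c • Finsupp.single t' 1 ∧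
      t'.deg = t.deg ∧ t'.energy ℓ ≤ t.energy ℓ := by
    intro p r
    rw [Module.End.mul_apply]
    rcases lower_bound (F := F) r t with h | ⟨t1, h1, h2, h3⟩
    -- A vanishing result is recorded as `0` times the original monomial, so that degree and energy
    -- conditions hold trivially.
    · exact ⟨t, 0, by rw [h, map_zero, zero_smul], rfl, le_rfl⟩
    rw [h1]
    rcases raise_energy_le hq p t1 with h | ⟨t2, c, e1, e2, e3⟩
    · exact ⟨t, 0, by rw [h, zero_smul], rfl, le_rfl⟩
    · exact ⟨t2, c, e1, by omega, e3.trans fun i => Nat.div_le_div_right (h3 i)⟩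
  cases g with
  | e j => exact key _ _
  | f j => exact key _ _
  | k i => exact ⟨t, _, diag_single _ _ _, rfl, le_rfl⟩
  | kinv i => exact ⟨t, _, diag_single _ _ _, rfl, le_rfl⟩

/-- Monomials with the same weight, degree and comparable energies are equal. -/
theorem eq_of_weight_eq (hq : HasQChar q ℓ) {t t' : Tuple m n} (hdeg : t'.deg = t.deg)
    (he : t'.energy ℓ ≤ t.energy ℓ)
    (hw : ∀ i : Fin (m + n), qAt q m i ^ entry (pos i) t' = qAt q m i ^ entry (pos i) t) :
    t' = t := by
  have hmod : ∀ p : Fin m ⊕ Fin n, entry p t' ≡ entry p t [MOD ℓ] := by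
    intro p
    have h := hw (finSumFinEquiv p)
    rw [pos, Equiv.symm_apply_apply, qAt] at h
    split_ifs at h
    · exact modEq_of_pow_eq hq h
    · rw [inv_pow, inv_pow, inv_inj] at h
      exact modEq_of_pow_eq hq h
  -- Even entries have equal remainders and comparable quotients modulo `ℓ`; odd entries are at most
  -- `1 < ℓ` and so equal their remainders. Equality of degrees then turns all these inequalities
  -- into equalities.
  have hle : ∀ p : Fin m ⊕ Fin n, entry p t' ≤ entry p t := by
    rintro (i | k)
    · have h1 : t'.1 i % ℓ = t.1 i % ℓ := hmod (.inl i)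
      rw [entry_inl, entry_inl, ← Nat.div_add_mod (t'.1 i) ℓ, ← Nat.div_add_mod (t.1 i) ℓ, h1]
      exact Nat.add_le_add_right (Nat.mul_le_mul_left _ (he i)) _
    · have h1 : (t'.2 k : ℕ) % ℓ = (t.2 k : ℕ) % ℓ := hmod (.inr k)
      have hl := hq.two_lt
      rw [entry_inr, entry_inr]
      rw [Nat.mod_eq_of_lt (by omega), Nat.mod_eq_of_lt (by omega)] at h1
      exact h1.le
  rw [deg_eq_sum_entry, deg_eq_sum_entry] at hdeg
  exact tuple_ext fun p =>
    (Finset.sum_eq_sum_iff_of_le fun p _ => hle p).1 hdeg p (Finset.mem_univ p)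

end Operators

/-! ### The action of the algebra in terms of coefficients of monomials. -/

section Action

variable {F : Type*} [Field F] {q : F} {ℓ m n : ℕ} (hq : HasQChar q ℓ)

theorem mkAlgHom_ι_smul (g : Gen m n) (v : Omega hq m n) :
    RingQuot.mkAlgHom F (Rel q ℓ m n) (FreeAlgebra.ι F g) • v = (genOp q g v : Tuple m n →₀ F) := by
  rw [smul_def, rep, RingQuot.liftAlgHom_mkAlgHom_apply, freeRep, FreeAlgebra.lift_ι_apply]

instance : IsScalarTower F (SmallQ q ℓ m n) (Omega hq m n) where
  smul_assoc c u v := by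
    rw [smul_def, smul_def, map_smul]
    rfl

instance : SMulCommClass (SmallQ q ℓ m n) F (Omega hq m n) where
  smul_comm u c v := map_smul (rep hq m n u) c v

/-- The coefficient of a monomial. -/
noncomputable def coeff (t : Tuple m n) : Omega hq m n →ₗ[F] F := Finsupp.lapply t

theorem coeff_mono_self (t : Tuple m n) : coeff hq t (mono hq t) = 1 :=
  Finsupp.single_eq_same

theorem coeff_mono_of_ne {t t' : Tuple m n} (h : t ≠ t') : coeff hq t (mono hq t') = 0 :=
  Finsupp.single_eq_of_ne h

theorem omega_ext {v w : Omega hq m n} (h : ∀ t, coeff hq t v = coeff hq t w) : v = w :=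
  Finsupp.ext h

theorem finite_coeff_ne_zero (v : Omega hq m n) : {t | coeff hq t v ≠ 0}.Finite :=
  Finsupp.hasFiniteSupport (show Tuple m n →₀ F from v)

theorem linearMap_eq_of_mono {W : Type*} [AddCommGroup W] [Module F W]
    {f g : Omega hq m n →ₗ[F] W} (h : ∀ t, f (mono hq t) = g (mono hq t)) : f = g :=
  Finsupp.lhom_ext' (M := F) (N := W) (φ := f) (ψ := g) fun t => LinearMap.ext_ring (h t)

/-- The degree is kept and the energy does not grow under the action on a monomial. -/
theorem smul_mono_mem_span (a : Tuple m n) (u : SmallQ q ℓ m n) :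
    u • mono hq a ∈
      Submodule.span F (mono hq '' {t | t.deg = a.deg ∧ t.energy ℓ ≤ a.energy ℓ}) := by
  refine smul_mem_span hq _ (fun g t ht => ?_) u _ (Submodule.subset_span ⟨a, ⟨rfl, le_rfl⟩, rfl⟩)
  obtain ⟨t', c, h1, h2, h3⟩ := genOp_energy_le hq g t
  exact ⟨t', ⟨h2.trans ht.1, h3.trans ht.2⟩, c, h1⟩

theorem coeff_eq_zero_of_mem_span {S : Set (Tuple m n)} {v : Omega hq m n}
    (hv : v ∈ Submodule.span F (mono hq '' S)) {t : Tuple m n} (ht : t ∉ S) :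
    coeff hq t v = 0 := by
  have : Submodule.span F (mono hq '' S) ≤ LinearMap.ker (coeff hq t) := by
    rw [Submodule.span_le]
    rintro _ ⟨t', ht', rfl⟩
    exact coeff_mono_of_ne hq fun e => ht (e ▸ ht')
  exact this hv

/-- The upper bound on cyclic submodules: it gives the necessity half of `reaches_iff`, and it
controls both supports in the argument on heads. -/
theorem coeff_smul_mono_ne_zero {a t : Tuple m n} {u : SmallQ q ℓ m n}
    (h : coeff hq t (u • mono hq a) ≠ 0) : t.deg = a.deg ∧ t.energy ℓ ≤ a.energy ℓ := by
  by_contra ht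
  exact h (coeff_eq_zero_of_mem_span hq (smul_mono_mem_span hq a u) ht)

/-- The monomial of `b` lies in the submodule generated by the monomial of `a`. -/
def Reaches (a b : Tuple m n) : Prop := ∃ u : SmallQ q ℓ m n, u • mono hq a = mono hq b

/-! ### Reachability between monomials. -/

variable {hq}

theorem Reaches.refl (a : Tuple m n) : Reaches hq a a := ⟨1, one_smul _ _⟩

theorem Reaches.trans {a b c : Tuple m n} : Reaches hq a b → Reaches hq b c → Reaches hq a c := by
  rintro ⟨u, hu⟩ ⟨w, hw⟩
  exact ⟨w * u, by rw [mul_smul, hu, hw]⟩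

theorem Reaches.deg_eq_and_energy_le {a b : Tuple m n} (h : Reaches hq a b) :
    b.deg = a.deg ∧ b.energy ℓ ≤ a.energy ℓ := by
  obtain ⟨u, hu⟩ := h
  refine coeff_smul_mono_ne_zero hq (u := u) ?_
  rw [hu, coeff_mono_self]
  exact one_ne_zero

theorem reaches_of_genOp {g : Gen m n} {a b : Tuple m n} {c : F} (hc : c ≠ 0)
    (h : genOp q g (Finsupp.single a 1) = c • Finsupp.single b 1) : Reaches hq a b := by
  refine ⟨c⁻¹ • RingQuot.mkAlgHom F (Rel q ℓ m n) (FreeAlgebra.ι F g), ?_⟩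
  have h' : (genOp q g (mono hq a) : Tuple m n →₀ F) = (c • mono hq b : Omega hq m n) := h
  rw [smul_assoc, mkAlgHom_ι_smul, h']
  exact inv_smul_smul₀ hc (mono hq b)

/-- The index in `{0, …, m + n - 1}` of a position. -/
def index (p : Fin m ⊕ Fin n) : ℕ := (finSumFinEquiv p : Fin (m + n))

theorem index_injective : Function.Injective (index : Fin m ⊕ Fin n → ℕ) :=
  Fin.val_injective.comp finSumFinEquiv.injective

theorem index_lt (p : Fin m ⊕ Fin n) : index p < m + n := (finSumFinEquiv p).isLt

theorem exists_index_eq {k : ℕ} (hk : k < m + n) : ∃ p : Fin m ⊕ Fin n, index p = k :=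
  ⟨finSumFinEquiv.symm ⟨k, hk⟩, by simp [index]⟩

theorem pos_eq_iff {i : Fin (m + n)} {p : Fin m ⊕ Fin n} : pos i = p ↔ i.1 = index p := by
  rw [pos, Equiv.symm_apply_eq, Fin.ext_iff, index]

theorem reaches_of_adjacent {p r : Fin m ⊕ Fin n}
    (hpr : index p + 1 = index r ∨ index r + 1 = index p) {t t' : Tuple m n}
    (hr : HasRoom ℓ t r) (h : IsShift p r t t') : Reaches hq t t' := by
  have hne : p ≠ r := by
    rintro rfl
    omega
  obtain ⟨c, hc, e⟩ := raise_mul_lower_eq_smul_single hq hne hr h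
  have h1 := index_lt p
  have h2 := index_lt r
  rcases hpr with hpr | hpr
  -- A unit moves up by one index under `f` and down by one index under `e`; the generator is
  -- numbered by the smaller of the two indices.
  · refine reaches_of_genOp (g := .f ⟨index p, by omega⟩) hc ?_
    rw [genOp, pos_eq_iff.2 (show (hi ⟨index p, by omega⟩ : Fin (m + n)).1 = index r from hpr),
      pos_eq_iff.2 (show (lo ⟨index p, by omega⟩ : Fin (m + n)).1 = index p from rfl), e]
  · refine reaches_of_genOp (g := .e ⟨index r, by omega⟩) hc ?_
    rw [genOp, pos_eq_iff.2 (show (hi ⟨index r, by omega⟩ : Fin (m + n)).1 = index p from hpr),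
      pos_eq_iff.2 (show (lo ⟨index r, by omega⟩ : Fin (m + n)).1 = index r from rfl), e]

/-- Induction on the distance between `p` and `r`, through the neighbour `x` of `p` on the side of
`r`. If `x` has room, it takes the unit from `p` and passes it on. If `x` is blocked, it first sends
a unit of its own to `r` and is refilled from `p`. Both orders end in the same tuple. -/
theorem reaches_of_isShift {p r : Fin m ⊕ Fin n} (hpr : p ≠ r) {t t' : Tuple m n}
    (hr : HasRoom ℓ t r) (h : IsShift p r t t') : Reaches hq t t' := by
  obtain ⟨d, hd⟩ : ∃ d, index p + d + 1 = index r ∨ index r + d + 1 = index p := by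
    rcases Nat.lt_or_gt_of_ne fun e => hpr (index_injective e) with h | h
    · exact ⟨index r - index p - 1, by omega⟩
    · exact ⟨index p - index r - 1, by omega⟩
  induction d generalizing p t t' with
  | zero => exact reaches_of_adjacent hd hr h
  | succ d ih =>
    obtain ⟨x, hx, hxr⟩ : ∃ x : Fin m ⊕ Fin n,
        (index p + 1 = index x ∨ index x + 1 = index p) ∧
        (index x + d + 1 = index r ∨ index r + d + 1 = index x) := by
      have h1 := index_lt p
      have h2 := index_lt r
      rcases hd with hd | hd
      · obtain ⟨x, hx⟩ := exists_index_eq (m := m) (n := n) (k := index p + 1) (by omega)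
        exact ⟨x, by omega, by omega⟩
      · obtain ⟨x, hx⟩ := exists_index_eq (m := m) (n := n) (k := index p - 1) (by omega)
        exact ⟨x, by omega, by omega⟩
    have hpx : p ≠ x := by
      rintro rfl
      omega
    have hxr' : x ≠ r := by
      rintro rfl
      omega
    have hs := h.source
    by_cases hroom : HasRoom ℓ t x
    · obtain ⟨t1, h1⟩ := exists_isShift hpx (by omega) hroom
      refine (reaches_of_adjacent hx hroom h1).trans
        (ih hxr' ((hasRoom_congr (h1.other r hpr.symm hxr'.symm)).2 hr) ⟨?_, ?_, fun y h2 h3 => ?_⟩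
          hxr)
      · rw [h.other x hpx.symm hxr', h1.target]
      · rw [h1.other r hpr.symm hxr'.symm, h.target]
      · by_cases hy : y = p
        · subst hy
          have := h1.source
          omega
        · rw [h.other y hy h3, h1.other y hy h2]
    · obtain ⟨t1, h1⟩ := exists_isShift hxr' (entry_pos_of_not_hasRoom hq.two_lt hroom) hr
      refine (ih hxr' hr h1 hxr).trans
        (reaches_of_adjacent hx (hasRoom_of_entry_add_one hq.two_lt hroom h1.source)
          ⟨?_, ?_, fun y h2 h3 => ?_⟩)
      · rw [h.source, h1.other p hpx hpr]
      · rw [h.other x hpx.symm hxr', h1.source]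
      · by_cases hy : y = r
        · rw [hy, h.target, h1.target]
        · rw [h.other y h2 hy, h1.other y h3 hy]

theorem reaches_iff {a b : Tuple m n} :
    Reaches hq a b ↔ b.deg = a.deg ∧ b.energy ℓ ≤ a.energy ℓ := by
  refine ⟨Reaches.deg_eq_and_energy_le, ?_⟩
  rintro ⟨hdeg, he⟩
  -- Subtraction is truncated, so the sum is the total surplus of `a` over `b`: positions where `a`
  -- falls short contribute nothing.
  induction hN : ∑ p, (entry p a - entry p b) using Nat.strong_induction_on generalizing a with
  | _ N ih =>
    by_cases hab : ∀ p, entry p b ≤ entry p a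
    · have hs : ∑ p, entry p b = ∑ p, entry p a := by
        rw [← deg_eq_sum_entry, ← deg_eq_sum_entry, hdeg]
      have := (Finset.sum_eq_sum_iff_of_le fun p _ => hab p).1 hs
      rw [tuple_ext fun p => (this p (Finset.mem_univ p))]
      exact Reaches.refl a
    push Not at hab
    obtain ⟨r, hr⟩ := hab
    -- A deficit at `r` must be balanced by a surplus elsewhere, because the degrees agree.
    obtain ⟨p, hp⟩ : ∃ p, entry p b < entry p a := by
      by_contra! hba
      have := Finset.sum_lt_sum (fun p _ => hba p) ⟨r, Finset.mem_univ r, hr⟩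
      rw [← deg_eq_sum_entry, ← deg_eq_sum_entry] at this
      omega
    have hpr : p ≠ r := by
      rintro rfl
      omega
    -- If `ℓ` divided `a_r + 1 ≤ b_r`, then `⌊b_r / ℓ⌋` would exceed `⌊a_r / ℓ⌋`, against the energy
    -- hypothesis. At an odd position a deficit means that the entry of `a` is `0`.
    have hroom : HasRoom ℓ a r := by
      rcases r with i | k
      · rw [entry_inl, entry_inl] at hr
        intro hd
        have h1 := he i
        simp only [Tuple.energy] at h1
        have h2 := Nat.succ_div_of_dvd hd
        have h3 : (a.1 i + 1) / ℓ ≤ b.1 i / ℓ := Nat.div_le_div_right hr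
        omega
      · rw [entry_inr, entry_inr] at hr
        have := (b.2 k).isLt
        exact Fin.ext (by simp; omega)
    obtain ⟨a', ha⟩ := exists_isShift hpr (by omega) hroom
    have hreach : Reaches hq a a' := reaches_of_isShift hpr hroom ha
    have hs := ha.source
    have ht := ha.target
    have hlt : ∑ x, (entry x a' - entry x b) < ∑ x, (entry x a - entry x b) := by
      refine Finset.sum_lt_sum (fun x _ => ?_) ⟨p, Finset.mem_univ p, by omega⟩
      by_cases hxp : x = p
      · subst hxp
        omega
      by_cases hxr : x = r
      · subst hxr
        omega
      rw [ha.other x hxp hxr]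
    -- The energy of `a'` still dominates that of `b`: the entry at `p` was strictly larger than in
    -- `b`, so it stays at least as large after losing one unit, and the entry at `r` only grew.
    refine hreach.trans (ih _ (hN ▸ hlt) (hdeg.trans hreach.deg_eq_and_energy_le.1.symm)
      (fun i => ?_) rfl)
    have hei := he i
    simp only [Tuple.energy, ← entry_inl (n := n) i] at hei ⊢
    by_cases hip : .inl i = p
    · subst hip
      exact Nat.div_le_div_right (by omega)
    by_cases hir : .inl i = r
    · subst hir
      rw [ht]
      exact hei.trans (Nat.div_le_div_right (Nat.le_succ _))
    · rwa [ha.other _ hip hir]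

/-! ### Isolating one monomial by means of the `K_i`. -/

variable (hq)

/-- `u` multiplies each monomial by a scalar, given by `d`. -/
def ActsDiagonally (u : SmallQ q ℓ m n) (d : Tuple m n → F) : Prop :=
  ∀ t, u • mono hq t = d t • mono hq t

variable {hq}

theorem ActsDiagonally.mul {u w : SmallQ q ℓ m n} {d e : Tuple m n → F}
    (hu : ActsDiagonally hq u d) (hw : ActsDiagonally hq w e) :
    ActsDiagonally hq (u * w) (d * e) := fun t => by
  rw [mul_smul, hw, smul_comm, hu, smul_smul, Pi.mul_apply, mul_comm]

theorem ActsDiagonally.coeff_smul {u : SmallQ q ℓ m n} {d : Tuple m n → F}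
    (hu : ActsDiagonally hq u d) (v : Omega hq m n) (t : Tuple m n) :
    coeff hq t (u • v) = d t * coeff hq t v := by
  have : (coeff hq t).comp (rep hq m n u : Omega hq m n →ₗ[F] Omega hq m n) =
      d t • coeff hq t := by
    refine linearMap_eq_of_mono hq fun r => ?_
    change coeff hq t (u • mono hq r) = d t * coeff hq t (mono hq r)
    rw [hu r, map_smul, smul_eq_mul]
    by_cases h : t = r
    · rw [h]
    · rw [coeff_mono_of_ne hq h, mul_zero, mul_zero]
  exact LinearMap.congr_fun this v

variable (hq)

theorem actsDiagonally_k (i : Fin (m + n)) (c : F) :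
    ActsDiagonally hq (RingQuot.mkAlgHom F (Rel q ℓ m n) (Kg F i) - algebraMap F _ c)
      (fun t => qAt q m i ^ entry (pos i) t - c) := fun t => by
  have h : (genOp q (.k i) (mono hq t) : Tuple m n →₀ F) =
      (qAt q m i ^ entry (pos i) t • mono hq t : Omega hq m n) := diag_single _ _ _
  rw [sub_smul, mkAlgHom_ι_smul, h, algebraMap_smul, sub_smul]

/-- Each `t ∈ T` differs from `a` in weight by `eq_of_weight_eq`, so some `K_i` minus its eigenvalue
at `t` kills `t` but not `a`. The product of these factors over `T` is the required element. -/
theorem exists_actsDiagonally_separating (a : Tuple m n) (T : Finset (Tuple m n))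
    (hT : ∀ t ∈ T, t ≠ a ∧ t.deg = a.deg ∧ t.energy ℓ ≤ a.energy ℓ) :
    ∃ (u : SmallQ q ℓ m n) (d : Tuple m n → F), ActsDiagonally hq u d ∧ d a ≠ 0 ∧
      ∀ t ∈ T, d t = 0 := by
  classical
  induction T using Finset.induction_on with
  | empty => exact ⟨1, 1, fun t => by simp, one_ne_zero, by simp⟩
  | insert t T _ ih =>
    obtain ⟨u, d, hu, ha, h0⟩ := ih fun x hx => hT x (Finset.mem_insert_of_mem hx)
    obtain ⟨hne, hdeg, he⟩ := hT t (Finset.mem_insert_self t T)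
    obtain ⟨i, hi⟩ : ∃ i : Fin (m + n),
        qAt q m i ^ entry (pos i) t ≠ qAt q m i ^ entry (pos i) a := by
      by_contra! h
      exact hne (eq_of_weight_eq hq hdeg he h)
    refine ⟨_, _, (actsDiagonally_k hq i (qAt q m i ^ entry (pos i) t)).mul hu,
      mul_ne_zero (sub_ne_zero.2 hi.symm) ha, fun x hx => ?_⟩
    rcases Finset.mem_insert.1 hx with rfl | hx
    · simp
    · simp [h0 x hx]

/-- A vector of the submodule generated by the monomial of `a` in which this monomial occurs
generates that submodule. -/
theorem exists_smul_eq_mono (a : Tuple m n) (u : SmallQ q ℓ m n)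
    (ha : coeff hq a (u • mono hq a) ≠ 0) :
    ∃ w : SmallQ q ℓ m n, w • u • mono hq a = mono hq a := by
  classical
  set v := u • mono hq a with hv
  -- `T` is the finite set of the other monomials occurring in `v`. What survives is the monomial of
  -- `a` with coefficient `d a * coeff hq a v`, which is then scaled to `1`.
  obtain ⟨w, d, hw, hda, hd⟩ := exists_actsDiagonally_separating hq a
    ((finite_coeff_ne_zero hq v).toFinset.erase a) (fun t ht => by
      rw [Finset.mem_erase, Set.Finite.mem_toFinset] at ht
      exact ⟨ht.1, coeff_smul_mono_ne_zero hq ht.2⟩)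
  refine ⟨(d a * coeff hq a v)⁻¹ • w, omega_ext hq fun t => ?_⟩
  rw [smul_assoc, map_smul, hw.coeff_smul, smul_eq_mul]
  by_cases h : t = a
  · rw [h, coeff_mono_self, inv_mul_cancel₀ (mul_ne_zero hda ha)]
  · rw [coeff_mono_of_ne hq h]
    by_cases h0 : coeff hq t v = 0
    · rw [h0, mul_zero, mul_zero]
    · rw [hd t (by simp [h, h0]), zero_mul, mul_zero]

end Action

/-! ### Radicals and heads over an arbitrary ring. -/

section Heads

variable {R M : Type*} [Ring R] [AddCommGroup M] [Module R M]

theorem headMap_injective {V N : Submodule R M} (h : radical V ≤ N) (hN : V ⊓ N ≤ radical V) :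
    Function.Injective (headMap V N h) := by
  rw [injective_iff_map_eq_zero]
  intro v hv
  obtain ⟨v, rfl⟩ := Submodule.Quotient.mk_surjective _ v
  change Submodule.Quotient.mk (v : M) = 0 at hv
  rw [Submodule.Quotient.mk_eq_zero] at hv ⊢
  obtain ⟨w, hw, e⟩ := hN ⟨v.2, hv⟩
  rwa [← Subtype.ext e]

/-- If `y + z` lies in `V` with `y ∈ Rad V` and `z ∈ Rad W`, then `z ∈ V ∩ W ⊆ Rad V`; this gives
injectivity. If `v` and `w` agree modulo the two radicals, then after correction by radical elements
they become one vector of `V ∩ W`, so `v ∈ Rad V`. -/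
theorem headsMeetTrivially_of_inf_le {V W : Submodule R M} (hV : V ⊓ W ≤ radical V)
    (hW : V ⊓ W ≤ radical W) : HeadsMeetTrivially V W := by
  have rV : radical V ≤ V := Submodule.map_subtype_le _ _
  have rW : radical W ≤ W := Submodule.map_subtype_le _ _
  refine ⟨headMap_injective _ ?_, headMap_injective _ ?_, ?_⟩
  · rintro x ⟨hx, h⟩
    obtain ⟨y, hy, z, hz, rfl⟩ := Submodule.mem_sup.1 h
    exact Submodule.add_mem _ hy (hV ⟨(Submodule.add_mem_iff_right _ (rV hy)).1 hx, rW hz⟩)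
  · rintro x ⟨hx, h⟩
    obtain ⟨y, hy, z, hz, rfl⟩ := Submodule.mem_sup.1 h
    exact Submodule.add_mem _ (hW ⟨rV hy, (Submodule.add_mem_iff_left _ (rW hz)).1 hx⟩) hz
  · rw [eq_bot_iff]
    rintro _ ⟨⟨v, rfl⟩, ⟨w, hw⟩⟩
    obtain ⟨v, rfl⟩ := Submodule.Quotient.mk_surjective _ v
    obtain ⟨w, rfl⟩ := Submodule.Quotient.mk_surjective _ w
    change Submodule.Quotient.mk (w : M) = Submodule.Quotient.mk (v : M) at hw
    change Submodule.Quotient.mk (v : M) = 0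
    rw [Submodule.Quotient.eq, Submodule.mem_sup] at hw
    rw [Submodule.Quotient.mk_eq_zero]
    obtain ⟨y, hy, z, hz, e⟩ := hw
    have e1 : (v : M) + y = w - z := by
      rw [eq_sub_iff_add_eq, add_assoc, e, add_sub_cancel]
    have h1 : (v : M) + y ∈ radical V :=
      hV ⟨Submodule.add_mem _ v.2 (rV hy), e1 ▸ Submodule.sub_mem _ w.2 (rW hz)⟩
    exact Submodule.mem_sup_left ((Submodule.add_mem_iff_left _ hy).1 h1)

/-- `R . x ⊓ W` lies in the radical of `R . x` if `x - w` generates `R . x` for all its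
elements `w`. -/
theorem cyclic_inf_le_radical {x : M} {W : Submodule R M}
    (h : ∀ w ∈ cyclic R x ⊓ W, ∃ r : R, r • (x - w) = x) :
    cyclic R x ⊓ W ≤ radical (cyclic R x) := by
  intro v hv
  refine ⟨⟨v, hv.1⟩, ?_, rfl⟩
  rw [Module.jacobson]
  refine Submodule.mem_sInf.2 fun N hN => ?_
  by_contra hvN
  -- A maximal `N` that misses `v` would give `x = y + u • v` with `y ∈ N`. As `u • v` is again in
  -- the intersection, the hypothesis makes `y = x - u • v` a generator, so that `x ∈ N`,
  -- contradicting that `N` is proper.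
  have hsup : N ⊔ Submodule.span R {(⟨v, hv.1⟩ : cyclic R x)} = ⊤ :=
    hN.2 _ (lt_of_le_of_ne le_sup_left fun e => hvN (e ▸
      (Submodule.mem_sup_right (Submodule.mem_span_singleton_self _))))
  have hx : x ∈ cyclic R x := Submodule.mem_span_singleton_self x
  obtain ⟨y, hy, z, hz, e⟩ := Submodule.mem_sup.1
    (hsup ▸ Submodule.mem_top : (⟨x, hx⟩ : cyclic R x) ∈ N ⊔ Submodule.span R {⟨v, hv.1⟩})
  obtain ⟨u, rfl⟩ := Submodule.mem_span_singleton.1 hz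
  obtain ⟨r, hr⟩ := h (u • v) (Submodule.smul_mem _ u hv)
  have ey : (y : M) = x - u • v := by
    rw [eq_sub_iff_add_eq]
    exact congrArg Subtype.val e
  have hxN : (⟨x, hx⟩ : cyclic R x) ∈ N := by
    have : (⟨x, hx⟩ : cyclic R x) = r • y := Subtype.ext (by
      rw [Submodule.coe_smul, ey, hr])
    rw [this]
    exact Submodule.smul_mem _ r hy
  refine hN.1 (eq_top_iff.2 fun y _ => ?_)
  obtain ⟨s, hs⟩ := Submodule.mem_span_singleton.1 y.2
  rw [show y = s • (⟨x, hx⟩ : cyclic R x) from Subtype.ext hs.symm]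
  exact Submodule.smul_mem _ s hxN

end Heads

/-! ### Comparison of cyclic submodules generated by monomials. -/

section Submodules

variable {F : Type*} [Field F] {q : F} {ℓ m n : ℕ} {hq : HasQChar q ℓ}
  {M : Submodule (SmallQ q ℓ m n) (Omega hq m n)} {x y : M} {a b : Tuple m n}

/-- Membership is tested by acting inside the ambient module, so it does not depend on `M`. Stating
it for any submodule `M` containing the monomials covers the full and the truncated case together.
-/
theorem mem_cyclic_iff_reaches (hx : (x : Omega hq m n) = mono hq a)
    (hy : (y : Omega hq m n) = mono hq b) :
    y ∈ cyclic (SmallQ q ℓ m n) x ↔ Reaches hq a b := by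
  rw [Submodule.mem_span_singleton, Reaches]
  refine exists_congr fun u => ?_
  rw [Subtype.ext_iff, Submodule.coe_smul, hx, hy]

theorem cyclic_le_cyclic_iff (hx : (x : Omega hq m n) = mono hq a)
    (hy : (y : Omega hq m n) = mono hq b) (hdeg : a.deg = b.deg) :
    cyclic (SmallQ q ℓ m n) y ≤ cyclic (SmallQ q ℓ m n) x ↔ b.energy ℓ ≤ a.energy ℓ := by
  rw [Submodule.span_singleton_le_iff_mem, mem_cyclic_iff_reaches hx hy, reaches_iff,
    and_iff_right hdeg.symm]

theorem cyclic_inf_cyclic_le_radical (hx : (x : Omega hq m n) = mono hq a)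
    (hy : (y : Omega hq m n) = mono hq b) (hab : ¬ a.energy ℓ ≤ b.energy ℓ) :
    cyclic (SmallQ q ℓ m n) x ⊓ cyclic (SmallQ q ℓ m n) y ≤
      radical (cyclic (SmallQ q ℓ m n) x) := by
  refine cyclic_inf_le_radical ?_
  rintro w ⟨hw1, hw2⟩
  obtain ⟨u, rfl⟩ := Submodule.mem_span_singleton.1 hw1
  obtain ⟨u', hu'⟩ := Submodule.mem_span_singleton.1 hw2
  have hu : u' • mono hq b = u • mono hq a := by
    rw [← hx, ← hy]
    exact congrArg Subtype.val hu'
  -- The same vector is a multiple of the monomial of `b`, in which the monomial of `a` cannot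
  -- occur, since that would require the energy of `a` to be at most that of `b`.
  have h0 : coeff hq a (u • mono hq a) = 0 := by
    by_contra h
    rw [← hu] at h
    exact hab (coeff_smul_mono_ne_zero hq h).2
  -- `(1 - u)` applied to the monomial of `a` is `x - w`, in which this monomial has coefficient
  -- `1`.
  obtain ⟨r, hr⟩ := exists_smul_eq_mono hq a (1 - u) (by
    rw [sub_smul, one_smul, map_sub, h0, sub_zero, coeff_mono_self]
    exact one_ne_zero)
  refine ⟨r, Subtype.ext ?_⟩
  rw [sub_smul, one_smul] at hr
  rw [Submodule.coe_smul, Submodule.coe_sub, Submodule.coe_smul, hx, hr]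

theorem eq_of_le_of_sum_eq {ι : Type*} [Fintype ι] {f g : ι → ℕ} (h : f ≤ g)
    (hs : ∑ i, f i = ∑ i, g i) : f = g :=
  funext fun i => (Finset.sum_eq_sum_iff_of_le fun i _ => h i).1 hs i (Finset.mem_univ i)

theorem cyclic_mono_comparison (hx : (x : Omega hq m n) = mono hq a)
    (hy : (y : Omega hq m n) = mono hq b) (hdeg : a.deg = b.deg) :
    (a.energy ℓ = b.energy ℓ → cyclic (SmallQ q ℓ m n) x = cyclic (SmallQ q ℓ m n) y) ∧
    (b.energy ℓ ≤ a.energy ℓ → a.energy ℓ ≠ b.energy ℓ →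
      cyclic (SmallQ q ℓ m n) y < cyclic (SmallQ q ℓ m n) x) ∧
    (∑ i, a.energy ℓ i = ∑ i, b.energy ℓ i → a.energy ℓ ≠ b.energy ℓ →
      HeadsMeetTrivially (cyclic (SmallQ q ℓ m n) x) (cyclic (SmallQ q ℓ m n) y)) := by
  refine ⟨fun h => le_antisymm ?_ ?_, fun h hne => lt_iff_le_not_ge.2 ⟨?_, fun h' => hne ?_⟩,
    fun hs hne => headsMeetTrivially_of_inf_le ?_ ?_⟩
  · exact (cyclic_le_cyclic_iff hy hx hdeg.symm).2 h.le
  · exact (cyclic_le_cyclic_iff hx hy hdeg).2 h.ge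
  · exact (cyclic_le_cyclic_iff hx hy hdeg).2 h
  · exact le_antisymm ((cyclic_le_cyclic_iff hy hx hdeg.symm).1 h') h
  -- Comparable energy vectors with equal sums coincide, so here the energies are incomparable in
  -- both directions.
  · exact cyclic_inf_cyclic_le_radical hx hy fun h => hne (eq_of_le_of_sum_eq h hs)
  · rw [inf_comm]
    exact cyclic_inf_cyclic_le_radical hy hx fun h => hne (eq_of_le_of_sum_eq h hs.symm).symm

end Submodules

end QGrass

theorem theorem14 {F : Type*} [Field F] [IsAlgClosed F] [CharZero F] {q : F} {ℓ m n : ℕ}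
    (hq : QGrass.HasQChar q ℓ) (hm : 2 ≤ m) (s : ℕ) :
    (∀ a b : QGrass.tuples m n s,
      (a.1.energy ℓ = b.1.energy ℓ →
        QGrass.cyclic (QGrass.SmallQ q ℓ m n) (QGrass.monoDeg hq a) =
          QGrass.cyclic (QGrass.SmallQ q ℓ m n) (QGrass.monoDeg hq b)) ∧
      (b.1.energy ℓ ≤ a.1.energy ℓ → a.1.energy ℓ ≠ b.1.energy ℓ →
        QGrass.cyclic (QGrass.SmallQ q ℓ m n) (QGrass.monoDeg hq b) <
          QGrass.cyclic (QGrass.SmallQ q ℓ m n) (QGrass.monoDeg hq a)) ∧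
      (∑ i, a.1.energy ℓ i = ∑ i, b.1.energy ℓ i → a.1.energy ℓ ≠ b.1.energy ℓ →
        QGrass.HeadsMeetTrivially
          (QGrass.cyclic (QGrass.SmallQ q ℓ m n) (QGrass.monoDeg hq a))
          (QGrass.cyclic (QGrass.SmallQ q ℓ m n) (QGrass.monoDeg hq b)))) ∧
    (∀ (r : ℕ) (hr : 0 < r) (a b : QGrass.truncTuples m n s ℓ r),
      (a.1.energy ℓ = b.1.energy ℓ →
        QGrass.cyclic (QGrass.SmallQ q ℓ m n) (QGrass.monoTrunc hq hr a) =
          QGrass.cyclic (QGrass.SmallQ q ℓ m n) (QGrass.monoTrunc hq hr b)) ∧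
      (b.1.energy ℓ ≤ a.1.energy ℓ → a.1.energy ℓ ≠ b.1.energy ℓ →
        QGrass.cyclic (QGrass.SmallQ q ℓ m n) (QGrass.monoTrunc hq hr b) <
          QGrass.cyclic (QGrass.SmallQ q ℓ m n) (QGrass.monoTrunc hq hr a)) ∧
      (∑ i, a.1.energy ℓ i = ∑ i, b.1.energy ℓ i → a.1.energy ℓ ≠ b.1.energy ℓ →
        QGrass.HeadsMeetTrivially
          (QGrass.cyclic (QGrass.SmallQ q ℓ m n) (QGrass.monoTrunc hq hr a))
          (QGrass.cyclic (QGrass.SmallQ q ℓ m n) (QGrass.monoTrunc hq hr b)))) :=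
  ⟨fun a b => QGrass.cyclic_mono_comparison rfl rfl (a.2.trans b.2.symm),
    fun _ _ a b => QGrass.cyclic_mono_comparison rfl rfl (a.2.1.trans b.2.1.symm)⟩
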